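/- Let $C\subset\mathbb{RP}^2$ be a nonsingular real algebraic curve of degree $5$, that is, the curve $F=0$ for a real form $F$ of degree $5$ in three variables whose partial derivatives have no common zero in $\mathbb{CP}^2$ lying on the curve. An \emph{oval} of $C$ is a connected component of the real part $\mathbb{R}C$ that bounds a disc in $\mathbb{RP}^2$; the interior of this disc is called the interior of the oval. Let $J$ be the pseudoline of $C$, that is, the component of $\mathbb{R}C$ that is not an oval. For two distinct points $x,y\in\mathbb{RP}^2\setminus J$, denote by $[x,y]_C$ the one of the two segments with endpoints $x,y$ of the projective line through $x$ and $y$ that intersects $J$ in an even number of points, counted with multiplicities. For three points $x,y,z$ in the interiors of three distinct ovals of $C$, the \emph{triangle} with vertices $x,y,z$ is the disc in $\mathbb{RP}^2\setminus J$ bounded by $[x,y]_C\cup[x,z]_C\cup[y,z]_C$. Ovals $O_1,\dots,O_n$ of $C$, $n\ge 3$, are \emph{in convex position} if, for points $x_1,\dots,x_n$ in the interiors of $O_1,\dots,O_n$ respectively (the condition does not depend on their choice), and for all $1\le i<j<k\le n$, the triangle with vertices $x_i,x_j,x_k$ contains none of the points $x_1,\dots,x_n$ in its interior. If $C$ is a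 nonsingular real curve of degree $5$ in $\mathbb{RP}^2$ such that $\mathbb{R}C$ has at least five ovals, then the ovals of $C$ are in convex position (for every choice of the points $x_i$). -/

import Mathlib

noncomputable section

namespace RealPlaneCurve

open MvPolynomial

/-- The real projective plane. -/
abbrev RP2 : Type := Projectivization ℝ (Fin 3 → ℝ)

/-- The usual topology of the real projective plane: the quotient topology of `ℝ³ ∖ {0}`. -/
instance instTopologicalSpaceRP2 : TopologicalSpace RP2 :=
  TopologicalSpace.coinduced
    (Projectivization.mk' ℝ : {v : Fin 3 → ℝ // v ≠ 0} → RP2) inferInstance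

/-- `v` is a vector of homogeneous coordinates of the point `p`. -/
def Represents (v : Fin 3 → ℝ) (p : RP2) : Prop :=
  ∃ h : v ≠ 0, Projectivization.mk ℝ v h = p

/-- The plane curve `F = 0` (for a real form `F`) is nonsingular: there is no complex point of
the curve at which all the partial derivatives of `F` vanish. -/
def IsNonsingular (F : MvPolynomial (Fin 3) ℝ) : Prop :=
  ∀ z : Fin 3 → ℂ, z ≠ 0 → aeval z F = 0 → ∃ i, aeval z (pderiv i F) ≠ 0

/-- The set of real points of the curve `F = 0`, where `F` is a form. -/
def realPart (F : MvPolynomial (Fin 3) ℝ) : Set RP2 :=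
  {p | eval p.rep F = 0}

/-- `D` is a closed disc embedded in the projective plane, with boundary `γ`: it is the image of
the closed unit disc under a topological embedding that maps the unit circle onto `γ`. The
topological frontier of `D` is then `γ` (for two-dimensional discs in a surface this is automatic,
by invariance of domain). -/
def IsClosedDisc (D γ : Set RP2) : Prop :=
  frontier D = γ ∧
  ∃ f : Metric.closedBall (0 : EuclideanSpace ℝ (Fin 2)) 1 → RP2,
    Topology.IsEmbedding f ∧ Set.range f = D ∧
      f '' {u | (u : EuclideanSpace ℝ (Fin 2)) ∈ Metric.sphere 0 1} = γ

/-- An oval of the curve `F = 0`: a connected component of the real part which bounds a disc in the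
projective plane. -/
def IsOval (F : MvPolynomial (Fin 3) ℝ) (O : Set RP2) : Prop :=
  (∃ p ∈ realPart F, O = connectedComponentIn (realPart F) p) ∧ ∃ D, IsClosedDisc D O

/-- The set of all the ovals of the curve `F = 0`. -/
def ovals (F : MvPolynomial (Fin 3) ℝ) : Set (Set RP2) :=
  {O | IsOval F O}

/-- The interior of an oval `O`: the interior of the disc bounded by `O`. -/
def ovalInterior (O : Set RP2) : Set RP2 :=
  {x | ∃ D, IsClosedDisc D O ∧ x ∈ interior D}

/-- The pseudoline of the curve `F = 0`: the part of the real part that is not made of ovals.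
For a nonsingular curve of odd degree it is a single connected component. -/
def pseudoline (F : MvPolynomial (Fin 3) ℝ) : Set RP2 :=
  {p | p ∈ realPart F ∧ ¬ IsOval F (connectedComponentIn (realPart F) p)}

/-- The image in the projective plane of the segment with endpoints `v₁`, `v₂` of `ℝ³`. If `v₁`,
`v₂` represent two distinct points `x₁`, `x₂`, this is one of the two segments with endpoints
`x₁`, `x₂` of the projective line through them; the other one is obtained
from `v₁`, `-v₂`. -/
def projSegment (v₁ v₂ : Fin 3 → ℝ) : Set RP2 :=
  {p | ∃ v ∈ segment ℝ v₁ v₂, Represents v p}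

/-- The restriction `t ↦ F ((1 - t) v₁ + t v₂)` of `F` to the line through `v₁` and `v₂`. -/
def restrictToLine (F : MvPolynomial (Fin 3) ℝ) (v₁ v₂ : Fin 3 → ℝ) : Polynomial ℝ :=
  aeval (fun i => (1 - Polynomial.X) * Polynomial.C (v₁ i) + Polynomial.X * Polynomial.C (v₂ i)) F

open Classical in
/-- The number of intersection points, counted with multiplicities, of the segment
`projSegment v₁ v₂` and the pseudoline of the curve `F = 0`. (At a point of the pseudoline, the
real part of a nonsingular curve coincides locally with the pseudoline, so that the
intersection multiplicity with a line is the order of vanishing of the restriction of `F`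
to that line.) -/
def pseudolineCount (F : MvPolynomial (Fin 3) ℝ) (v₁ v₂ : Fin 3 → ℝ) : ℕ :=
  ((restrictToLine F v₁ v₂).roots.filter (fun t => t ∈ Set.Icc (0 : ℝ) 1 ∧
    ∃ p ∈ pseudoline F, Represents ((1 - t) • v₁ + t • v₂) p)).card

/-- `S` is the segment `[x₁, x₂]_C` determined by the curve `C` given by `F = 0`: of the two
segments with distinct endpoints `x₁`, `x₂`, the one that intersects the pseudoline in an even
number of points, counted with multiplicities. -/
def IsCurveSegment (F : MvPolynomial (Fin 3) ℝ) (x₁ x₂ : RP2) (S : Set RP2) : Prop :=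
  x₁ ≠ x₂ ∧ ∃ v₁ v₂ : Fin 3 → ℝ, Represents v₁ x₁ ∧ Represents v₂ x₂ ∧
    S = projSegment v₁ v₂ ∧ Even (pseudolineCount F v₁ v₂)

/-- `T` is the triangle with vertices `x₁`, `x₂`, `x₃` determined by the curve `C` given by `F = 0`:
the disc in the complement of the pseudoline which is bounded by the union of the segments
`[x₁, x₂]_C`, `[x₁, x₃]_C` and `[x₂, x₃]_C`. -/
def IsTriangle (F : MvPolynomial (Fin 3) ℝ) (x₁ x₂ x₃ : RP2) (T : Set RP2) : Prop :=
  ∃ S₁₂ S₁₃ S₂₃ : Set RP2,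
    IsCurveSegment F x₁ x₂ S₁₂ ∧ IsCurveSegment F x₁ x₃ S₁₃ ∧ IsCurveSegment F x₂ x₃ S₂₃ ∧
    T ⊆ (pseudoline F)ᶜ ∧ IsClosedDisc T (S₁₂ ∪ S₁₃ ∪ S₂₃)

/-- A collection `O` of distinct ovals of the curve `F = 0` is in convex position: for every choice
of points `x i` in the interiors of the ovals `O i`, no triangle with vertices at three of these
points contains one of the points in its interior. -/
def InConvexPosition (F : MvPolynomial (Fin 3) ℝ) {ι : Type*} (O : ι → Set RP2) : Prop :=
  ∀ x : ι → RP2, (∀ i, x i ∈ ovalInterior (O i)) →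
    ∀ i j k : ι, i ≠ j → i ≠ k → j ≠ k →
      ∀ T : Set RP2, IsTriangle F (x i) (x j) (x k) T → ∀ m : ι, x m ∉ interior T

end RealPlaneCurve

end

/-! The engine is Bézout counting on rational curves. A closed curve in the plane with points inside
and outside the disc of an oval meets that oval at least twice (`exists_two_crossings`,
`exists_finset_crossings`). A projective line always leaves a disc, because it is a one-sided loop
(`exists_not_mem_of_line`). So a line through the interiors of three ovals would have 6 > 5
intersections with the quintic (`not_three_on_line`). Consequently the discs are not nested and no
three chosen points are collinear.

Signs replace the topology of the pseudoline. Along a curve that meets F = 0 only on ovals, F times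
a sign recording inside or outside for each oval keeps one sign, so F has equal signs at endpoints
lying in single discs (`eval_mul_eval_pos`). On a line through two ovals at most one intersection is
left for the pseudoline, hence an even count is zero (`eval_mul_eval_pos_of_even`). As the degree is
odd, each chosen point has representatives with F > 0, and [x,y]_C is the segment between such
representatives (`IsCurveSegment.exists_pos`). The interior of a triangle then consists of positive
combinations of positive representatives of its vertices (`exists_pos_of_mem_interior`).

Suppose a fourth point is such a combination; after rescaling it is v₀ + v₁ + v₂. The conic through
these four points and a point of a fifth oval meets the five ovals in at least 10 = 2 · 5 points, so
it has no other intersection with the quintic and F keeps its sign along it. With parameters m₀, m₁,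
m₂ at the vertices, the conic passes through (mᵢ - mⱼ)(mᵢ - mₖ) vᵢ, so these three products would
have equal signs. But the middle parameter gives a negative product and the outer ones positive
products (`false_of_conic`). -/

open Set Filter Topology MvPolynomial

namespace RealPlaneCurve

noncomputable section


/-! ### Homogeneous coordinates and the quotient topology. -/

/-- The canonical projection of `ℝ³` to the projective plane, with an arbitrary value at `0`. -/
def toRP (v : Fin 3 → ℝ) : RP2 :=
  open Classical in if h : v ≠ 0 then Projectivization.mk ℝ v h else Classical.arbitrary RP2

theorem toRP_of_ne {v : Fin 3 → ℝ} (h : v ≠ 0) : toRP v = Projectivization.mk ℝ v h := by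
  simp [toRP, h]

theorem represents_iff {v : Fin 3 → ℝ} {p : RP2} : Represents v p ↔ v ≠ 0 ∧ toRP v = p := by
  constructor
  · rintro ⟨h, rfl⟩
    exact ⟨h, toRP_of_ne h⟩
  · rintro ⟨h, rfl⟩
    exact ⟨h, (toRP_of_ne h).symm⟩

theorem toRP_rep (p : RP2) : toRP p.rep = p := by
  rw [toRP_of_ne p.rep_nonzero, Projectivization.mk_rep]

theorem toRP_smul {v : Fin 3 → ℝ} {r : ℝ} (hr : r ≠ 0) : toRP (r • v) = toRP v := by
  by_cases hv : v = 0
  · simp [hv]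
  · rw [toRP_of_ne hv, toRP_of_ne (smul_ne_zero hr hv), Projectivization.mk_eq_mk_iff']
    exact ⟨r, rfl⟩

theorem exists_smul_of_toRP_eq {v w : Fin 3 → ℝ} (hv : v ≠ 0) (hw : w ≠ 0)
    (h : toRP v = toRP w) : ∃ r : ℝ, r ≠ 0 ∧ v = r • w := by
  rw [toRP_of_ne hv, toRP_of_ne hw, Projectivization.mk_eq_mk_iff'] at h
  obtain ⟨r, hr⟩ := h
  refine ⟨r, ?_, hr.symm⟩
  rintro rfl
  exact hv (by rw [← hr, zero_smul])

theorem continuous_mk' :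
    Continuous (Projectivization.mk' ℝ : {v : Fin 3 → ℝ // v ≠ 0} → RP2) :=
  continuous_coinduced_rng

theorem continuousOn_toRP : ContinuousOn toRP {v | v ≠ 0} := by
  rw [continuousOn_iff_continuous_domRestrict]
  exact continuous_mk'.congr fun v => (toRP_of_ne v.2).symm

theorem continuousAt_toRP {v : Fin 3 → ℝ} (hv : v ≠ 0) : ContinuousAt toRP v :=
  continuousOn_toRP.continuousAt (isOpen_ne.mem_nhds hv)

theorem continuous_RP2_iff {X : Type*} [TopologicalSpace X] {g : RP2 → X} :
    Continuous g ↔ ContinuousOn (g ∘ toRP) {v | v ≠ 0} := by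
  rw [continuousOn_iff_continuous_domRestrict]
  have : {v : Fin 3 → ℝ | v ≠ 0}.domRestrict (g ∘ toRP)
      = g ∘ (Projectivization.mk' ℝ : {v : Fin 3 → ℝ // v ≠ 0} → RP2) :=
    funext fun v => congrArg g (toRP_of_ne v.2)
  rw [this]
  exact continuous_coinduced_dom

/-- The saturation of an open set under rescaling is a union of open dilates. -/
theorem isOpen_image_toRP {U : Set (Fin 3 → ℝ)} (hU : IsOpen U) :
    IsOpen (toRP '' (U ∩ {v | v ≠ 0})) := by
  have : IsOpen {w : {v : Fin 3 → ℝ // v ≠ 0} | ∃ r : ℝ, r ≠ 0 ∧ r • (w : Fin 3 → ℝ) ∈ U} := by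
    have : {w : {v : Fin 3 → ℝ // v ≠ 0} | ∃ r : ℝ, r ≠ 0 ∧ r • (w : Fin 3 → ℝ) ∈ U}
        = ⋃ r ∈ {r : ℝ | r ≠ 0}, (fun w : {v : Fin 3 → ℝ // v ≠ 0} => r • (w : Fin 3 → ℝ)) ⁻¹' U := by
      ext w; simp
    rw [this]
    exact isOpen_biUnion fun r _ => hU.preimage (by fun_prop)
  rw [isOpen_coinduced]
  convert this using 1
  ext ⟨w, hw⟩
  simp only [mem_preimage, mem_image, mem_inter_iff, mem_ofPred_eq, Projectivization.mk'_eq_mk]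
  rw [← toRP_of_ne hw]
  constructor
  · rintro ⟨v, ⟨hvU, hv⟩, h⟩
    obtain ⟨r, hr, rfl⟩ := exists_smul_of_toRP_eq hv hw h
    exact ⟨r, hr, hvU⟩
  · rintro ⟨r, hr, h⟩
    exact ⟨_, ⟨h, smul_ne_zero hr hw⟩, toRP_smul hr⟩

theorem toRP_mem_interior {D : Set RP2} {v : Fin 3 → ℝ} (hv : v ≠ 0)
    (h : ∀ᶠ w in 𝓝 v, toRP w ∈ D) : toRP v ∈ interior D := by
  obtain ⟨U, hU, hUo, hvU⟩ := eventually_nhds_iff.1 h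
  refine mem_interior.2 ⟨_, ?_, isOpen_image_toRP hUo, mem_image_of_mem _ ⟨hvU, hv⟩⟩
  rintro _ ⟨w, ⟨hw, -⟩, rfl⟩
  exact hU w hw

/-! ### Closed discs -/

namespace IsClosedDisc

variable {D γ : Set RP2}

theorem boundary_subset (h : IsClosedDisc D γ) : γ ⊆ D := by
  obtain ⟨-, f, -, rfl, rfl⟩ := h
  exact image_subset_range _ _

theorem isClosed (h : IsClosedDisc D γ) : IsClosed D := by
  rw [← closure_subset_iff_isClosed, closure_eq_interior_union_frontier, h.1]
  exact union_subset interior_subset h.boundary_subset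

theorem interior_eq (h : IsClosedDisc D γ) : interior D = D \ γ := by
  rw [← h.1, self_sdiff_frontier]

theorem isPreconnected (h : IsClosedDisc D γ) : IsPreconnected D := by
  obtain ⟨-, f, hf, rfl, -⟩ := h
  have : PreconnectedSpace (Metric.closedBall (0 : EuclideanSpace ℝ (Fin 2)) 1) :=
    isPreconnected_iff_preconnectedSpace.1 (convex_closedBall _ _).isPreconnected
  exact isPreconnected_range hf.continuous

/-- The open ball is dense in the closed ball, and the embedding carries it off the boundary `γ`. -/
theorem subset_closure_interior (h : IsClosedDisc D γ) : D ⊆ closure (interior D) := by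
  rw [h.interior_eq]
  obtain ⟨-, f, hf, rfl, rfl⟩ := h
  rintro _ ⟨u, rfl⟩
  have hd : u ∈ closure {w : Metric.closedBall (0 : EuclideanSpace ℝ (Fin 2)) 1 |
      (w : EuclideanSpace ℝ (Fin 2)) ∈ Metric.ball 0 1} := by
    rw [closure_subtype]
    have h1 : ((↑) : Metric.closedBall (0 : EuclideanSpace ℝ (Fin 2)) 1 → EuclideanSpace ℝ (Fin 2)) ''
        {w | (w : EuclideanSpace ℝ (Fin 2)) ∈ Metric.ball 0 1} = Metric.ball 0 1 := by
      ext w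
      constructor
      · rintro ⟨w, hw, rfl⟩; exact hw
      · intro hw; exact ⟨⟨w, Metric.ball_subset_closedBall hw⟩, hw, rfl⟩
    rw [h1, closure_ball _ one_ne_zero]
    exact u.2
  refine closure_mono ?_ (image_closure_subset_closure_image hf.continuous ⟨u, hd, rfl⟩)
  rintro _ ⟨w, hw, rfl⟩
  refine ⟨mem_range_self w, ?_⟩
  rintro ⟨w', hw', he⟩
  rw [hf.injective he] at hw'
  simp only [mem_ofPred_eq, Metric.mem_sphere, Metric.mem_ball] at hw hw'
  linarith

theorem not_mem_boundary_of_mem_interior (h : IsClosedDisc D γ) {p : RP2} (hp : p ∈ interior D) :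
    p ∉ γ := by
  rw [h.interior_eq] at hp
  exact hp.2

theorem mem_trichotomy (h : IsClosedDisc D γ) (p : RP2) : p ∈ interior D ∨ p ∈ γ ∨ p ∈ Dᶜ := by
  rw [h.interior_eq]
  by_cases h1 : p ∈ D <;> by_cases h2 : p ∈ γ <;> simp [h1, h2]

/-- A connected set that misses the boundary of a disc lies inside or outside. -/
theorem subset_or_subset (h : IsClosedDisc D γ) {P : Set RP2} (hP : IsPreconnected P)
    (hd : ∀ p ∈ P, p ∉ γ) : P ⊆ interior D ∨ P ⊆ Dᶜ := by
  refine hP.subset_or_subset isOpen_interior h.isClosed.isOpen_compl ?_ ?_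
  · exact disjoint_compl_right.mono_left interior_subset
  · intro p hp
    rcases h.mem_trichotomy p with h1 | h1 | h1
    · exact Or.inl h1
    · exact absurd h1 (hd p hp)
    · exact Or.inr h1

end IsClosedDisc

/-! ### Lifting discs -/

/-- The orthogonal projection of `ℝ³` onto the line spanned by `v`. -/
def orthProj (v : Fin 3 → ℝ) : (Fin 3 → ℝ) →L[ℝ] (Fin 3 → ℝ) :=
  LinearMap.toContinuousLinearMap
    { toFun := fun w => ((v ⬝ᵥ w) / (v ⬝ᵥ v)) • v
      map_add' := fun x y => by rw [dotProduct_add, add_div, add_smul]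
      map_smul' := fun r x => by
        rw [dotProduct_smul, smul_eq_mul, mul_div_assoc, mul_smul, RingHom.id_apply] }

theorem orthProj_apply (v w : Fin 3 → ℝ) : orthProj v w = ((v ⬝ᵥ w) / (v ⬝ᵥ v)) • v := rfl

theorem orthProj_smul {r : ℝ} (hr : r ≠ 0) (v : Fin 3 → ℝ) : orthProj (r • v) = orthProj v := by
  ext1 w
  simp only [orthProj_apply, smul_dotProduct, dotProduct_smul, smul_eq_mul, smul_smul]
  congr 1
  by_cases h : v ⬝ᵥ v = 0
  · simp [h]
  · field_simp

theorem orthProj_self {v : Fin 3 → ℝ} : orthProj v v = v := by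
  by_cases h : v = 0
  · simp [h]
  · rw [orthProj_apply, div_self (by rwa [Ne, dotProduct_self_eq_zero]), one_smul]

/-- The choice `rep` need not be continuous, but the projection onto a line through the origin does
not depend on the vector chosen on it. -/
theorem continuous_orthProj_rep : Continuous fun p : RP2 => orthProj p.rep := by
  rw [continuous_RP2_iff]
  have : EqOn ((fun p : RP2 => orthProj p.rep) ∘ toRP) orthProj {v : Fin 3 → ℝ | v ≠ 0} := by
    intro v hv
    obtain ⟨r, hr, h⟩ := exists_smul_of_toRP_eq (Projectivization.rep_nonzero _) hv
      (toRP_rep (toRP v))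
    simp only [Function.comp]
    rw [h, orthProj_smul hr]
  refine ContinuousOn.congr ?_ this
  rw [continuousOn_clm_apply]
  intro w
  simp only [orthProj_apply]
  have h1 : Continuous fun v : Fin 3 → ℝ => v ⬝ᵥ w := continuous_id.dotProduct continuous_const
  have h2 : Continuous fun v : Fin 3 → ℝ => v ⬝ᵥ v := continuous_id.dotProduct continuous_id
  refine (h1.continuousOn.div h2.continuousOn fun v hv => ?_).smul continuousOn_id
  rwa [Ne, dotProduct_self_eq_zero]

theorem represents_orthProj {p : RP2} {w : Fin 3 → ℝ} (h : orthProj p.rep w ≠ 0) :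
    Represents (orthProj p.rep w) p := by
  refine represents_iff.2 ⟨h, ?_⟩
  rw [orthProj_apply] at h ⊢
  rw [toRP_smul (left_ne_zero_of_smul h), toRP_rep]

/-- A continuous map from a closed ball to the projective plane lifts to `ℝ³ ∖ {0}`. -/
theorem exists_lift {E : Type*} [NormedAddCommGroup E] [NormedSpace ℝ E] [ProperSpace E]
    {f : Metric.closedBall (0 : E) 1 → RP2} (hf : Continuous f) :
    ∃ s : Metric.closedBall (0 : E) 1 → (Fin 3 → ℝ), Continuous s ∧ ∀ u, Represents (s u) (f u) := by
  let M : Metric.closedBall (0 : E) 1 → (Fin 3 → ℝ) →L[ℝ] (Fin 3 → ℝ) :=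
    fun u => orthProj (f u).rep
  have hM : Continuous M := continuous_orthProj_rep.comp hf
  have : CompactSpace (Metric.closedBall (0 : E) 1) :=
    isCompact_iff_compactSpace.1 (isCompact_closedBall _ _)
  have hu := CompactSpace.uniformContinuous_of_continuous hM
  -- Two projections at operator distance less than 1: a nonzero vector fixed by one is not killed
  -- by the other. A lift can thus be transported by projecting it onto the next line.
  obtain ⟨δ, hδ, hMδ⟩ := Metric.uniformContinuous_iff.1 hu 1 one_pos
  obtain ⟨n, hn⟩ := exists_nat_one_div_lt hδ
  -- The radius grows from 0, where the lift is constant, to 1 at k = n + 1, in steps shorter than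
  -- δ.
  let t : ℕ → ℝ := fun k => min 1 (k / (n + 1 : ℝ))
  have ht0 : ∀ k, 0 ≤ t k := fun k => le_min zero_le_one (by positivity)
  have ht1 : ∀ k, t k ≤ 1 := fun k => min_le_left _ _
  let sc : ℕ → Metric.closedBall (0 : E) 1 → Metric.closedBall (0 : E) 1 := fun k u =>
    ⟨t k • (u : E), by
      have := u.2
      rw [mem_closedBall_zero_iff] at this ⊢
      rw [norm_smul, Real.norm_of_nonneg (ht0 k)]
      exact mul_le_one₀ (ht1 k) (norm_nonneg _) this⟩
  have hsc : ∀ k, Continuous (sc k) := fun k => by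
    refine Continuous.subtype_mk ?_ _
    fun_prop
  have hstep : ∀ k u, dist (sc (k + 1) u) (sc k u) < δ := by
    intro k u
    rw [Subtype.dist_eq, dist_eq_norm]
    change ‖t (k + 1) • (u : E) - t k • (u : E)‖ < δ
    rw [← sub_smul, norm_smul]
    have h1 : ‖(u : E)‖ ≤ 1 := mem_closedBall_zero_iff.1 u.2
    have h2 : ‖t (k + 1) - t k‖ ≤ 1 / (n + 1 : ℝ) := by
      have h3 : ((k + 1 : ℕ) : ℝ) / (n + 1 : ℝ) = k / (n + 1 : ℝ) + 1 / (n + 1 : ℝ) := by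
        push_cast; ring
      have h4 : (0 : ℝ) < 1 / (n + 1 : ℝ) := by positivity
      simp only [t, h3, Real.norm_eq_abs, abs_le]
      constructor
      · have := min_le_min (le_refl (1 : ℝ)) (by linarith : k / (n + 1 : ℝ) ≤ k / (n + 1 : ℝ) + 1 / (n + 1 : ℝ))
        linarith
      · rcases min_cases (1 : ℝ) (k / (n + 1 : ℝ)) with h | h
        · have := min_le_left (1 : ℝ) (k / (n + 1 : ℝ) + 1 / (n + 1 : ℝ))
          linarith
        · have := min_le_right (1 : ℝ) (k / (n + 1 : ℝ) + 1 / (n + 1 : ℝ))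
          linarith
    nlinarith [norm_nonneg (u : E), norm_nonneg (t (k + 1) - t k)]
  have key : ∀ k, ∃ s : Metric.closedBall (0 : E) 1 → (Fin 3 → ℝ), Continuous s ∧
      ∀ u, Represents (s u) (f (sc k u)) := by
    intro k
    induction k with
    | zero =>
      refine ⟨fun _ => (f ⟨0, by simp⟩).rep, continuous_const, fun u => ?_⟩
      have : sc 0 u = ⟨0, by simp⟩ := by
        simp [sc, t]
      rw [this]
      exact represents_iff.2 ⟨Projectivization.rep_nonzero _, toRP_rep _⟩
    | succ k ih =>
      obtain ⟨s, hs, hr⟩ := ih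
      refine ⟨fun u => M (sc (k + 1) u) (s u), (hM.comp (hsc _)).clm_apply hs, fun u => ?_⟩
      apply represents_orthProj
      obtain ⟨h0, h1⟩ := represents_iff.1 (hr u)
      have h2 : M (sc k u) (s u) = s u := by
        obtain ⟨r, hr0, h⟩ := exists_smul_of_toRP_eq (Projectivization.rep_nonzero (f (sc k u))) h0
          ((toRP_rep _).trans h1.symm)
        simp only [M]
        rw [h, orthProj_smul hr0, orthProj_self]
      intro h3
      have h4 := (M (sc (k + 1) u) - M (sc k u)).le_opNorm (s u)
      have h5 : M (sc (k + 1) u) (s u) = 0 := h3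
      rw [sub_apply, h5, h2, zero_sub, norm_neg] at h4
      have h6 := hMδ (hstep k u)
      rw [dist_eq_norm] at h6
      have h7 : 0 < ‖s u‖ := norm_pos_iff.2 h0
      nlinarith
  obtain ⟨s, hs, hr⟩ := key (n + 1)
  refine ⟨s, hs, fun u => ?_⟩
  have : sc (n + 1) u = u := by
    have : t (n + 1) = 1 := by
      simp only [t]
      push_cast
      rw [div_self (by positivity), min_self]
    ext1
    simp [sc, this]
  simpa only [this] using hr u

/-- A disc in the projective plane does not contain a projective line. -/
theorem IsClosedDisc.exists_not_mem_of_line {D γ : Set RP2} (hD : IsClosedDisc D γ)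
    {a b : Fin 3 → ℝ} (hab : ∀ s t : ℝ, s • a + t • b = 0 → s = 0 ∧ t = 0) :
    ∃ s t : ℝ, s • a + t • b ≠ 0 ∧ toRP (s • a + t • b) ∉ D := by
  by_contra! hcon
  obtain ⟨-, f, hf, rfl, -⟩ := hD
  obtain ⟨s, hs, hr⟩ := exists_lift hf.continuous
  let c : ℝ → Fin 3 → ℝ := fun θ => Real.cos θ • a + Real.sin θ • b
  have hc : Continuous c := by fun_prop
  have hc0 : ∀ θ, c θ ≠ 0 := by
    intro θ h
    obtain ⟨h1, h2⟩ := hab _ _ h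
    have := Real.sin_sq_add_cos_sq θ
    rw [h1, h2] at this
    norm_num at this
  choose u hu using fun θ => hcon (Real.cos θ) (Real.sin θ) (hc0 θ)
  have huc : Continuous u := by
    rw [hf.isInducing.continuous_iff]
    have : f ∘ u = toRP ∘ c := funext hu
    rw [this]
    exact continuousOn_toRP.comp_continuous hc hc0
  -- `s (u θ)` and `c θ` are nonzero multiples of each other, so `φ` never vanishes. Half a turn
  -- closes the loop in the plane but negates `c`, so `φ` changes sign.
  let φ : ℝ → ℝ := fun θ => s (u θ) ⬝ᵥ c θ
  have hφ : Continuous φ := (hs.comp huc).dotProduct hc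
  have hφ0 : ∀ θ, φ θ ≠ 0 := by
    intro θ
    obtain ⟨h1, h2⟩ := represents_iff.1 (hr (u θ))
    obtain ⟨r, hr0, h⟩ := exists_smul_of_toRP_eq h1 (hc0 θ) (h2.trans (hu θ))
    simp only [φ, h, smul_dotProduct, smul_eq_mul]
    refine mul_ne_zero hr0 ?_
    rw [Ne, dotProduct_self_eq_zero]
    exact hc0 θ
  have hcπ : c Real.pi = -c 0 := by simp [c]
  have huπ : u Real.pi = u 0 := by
    apply hf.injective
    rw [hu, hu]
    change toRP (c Real.pi) = toRP (c 0)
    rw [hcπ, ← neg_one_smul ℝ, toRP_smul (by norm_num)]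
  have hneg : φ Real.pi = -φ 0 := by
    simp only [φ, huπ, hcπ, dotProduct_neg]
  rcases le_total (φ 0) 0 with h | h
  · obtain ⟨θ, hθ⟩ := mem_range_of_exists_le_of_exists_ge hφ ⟨0, h⟩ ⟨Real.pi, by rw [hneg]; linarith⟩
    exact hφ0 θ hθ
  · obtain ⟨θ, hθ⟩ := mem_range_of_exists_le_of_exists_ge hφ ⟨Real.pi, by rw [hneg]; linarith⟩ ⟨0, h⟩
    exact hφ0 θ hθ


/-! ### Polynomial functions near a real point of a nonsingular curve -/

theorem hasStrictFDerivAt_eval (F : MvPolynomial (Fin 3) ℝ) (v : Fin 3 → ℝ) :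
    HasStrictFDerivAt (fun w => eval w F)
      (∑ i, eval v (pderiv i F) • ContinuousLinearMap.proj (R := ℝ) (φ := fun _ : Fin 3 => ℝ) i)
      v := by
  induction F using MvPolynomial.induction_on with
  | C a =>
    simp only [eval_C, pderiv_C, map_zero, zero_smul, Finset.sum_const_zero]
    exact hasStrictFDerivAt_const a v
  | add p q hp hq =>
    simp only [map_add, add_smul, Finset.sum_add_distrib]
    exact hp.add hq
  | mul_X p n hp =>
    simp only [map_mul, eval_X]
    refine (hp.mul (hasStrictFDerivAt_apply n v)).congr_fderiv ?_
    ext1 w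
    simp [pderiv_X, Pi.single_apply, mul_add, Finset.sum_add_distrib, Finset.mul_sum, mul_comm,
      mul_left_comm, apply_ite (eval v)]

theorem continuous_eval_mv (F : MvPolynomial (Fin 3) ℝ) : Continuous fun v => eval v F :=
  MvPolynomial.continuous_eval F

theorem IsNonsingular.exists_pderiv_ne_zero {F : MvPolynomial (Fin 3) ℝ} (h : IsNonsingular F)
    {v : Fin 3 → ℝ} (hv : v ≠ 0) (hF : eval v F = 0) : ∃ i, eval v (pderiv i F) ≠ 0 := by
  have key : ∀ G : MvPolynomial (Fin 3) ℝ,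
      aeval (algebraMap ℝ ℂ ∘ v) G = ((eval v G : ℝ) : ℂ) := fun G =>
    MvPolynomial.aeval_algebraMap_apply ℂ v G
  obtain ⟨i, hi⟩ := h (algebraMap ℝ ℂ ∘ v)
    (fun h0 => hv (funext fun i => by simpa using congrFun h0 i)) (by rw [key, hF]; rfl)
  refine ⟨i, fun h0 => hi ?_⟩
  rw [key, h0]
  rfl

theorem frequently_eval_ne_zero {F : MvPolynomial (Fin 3) ℝ} (hF : F ≠ 0) (v : Fin 3 → ℝ) :
    ∃ᶠ w in 𝓝 v, eval w F ≠ 0 := by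
  intro h
  have h1 : (fun w => eval w F) =ᶠ[𝓝 v] fun _ => 0 := h.mono fun w hw => by simpa using hw
  have h2 := AnalyticOnNhd.eq_of_eventuallyEq (AnalyticOnNhd.eval_mvPolynomial F)
    analyticOnNhd_const h1
  exact hF (MvPolynomial.funext fun w => by simpa using congrFun h2 w)

/-- Near a regular zero of `f` the sets `f > 0` and `f < 0` are connected. -/
theorem exists_isOpen_isPreconnected {f : (Fin 3 → ℝ) → ℝ} {f' : (Fin 3 → ℝ) →L[ℝ] ℝ}
    {a : Fin 3 → ℝ} (hf : HasStrictFDerivAt f f' a) (hf' : f' ≠ 0) (ha : f a = 0)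
    {U : Set (Fin 3 → ℝ)} (hU : U ∈ 𝓝 a) :
    ∃ N ⊆ U, IsOpen N ∧ a ∈ N ∧ IsPreconnected (N ∩ {w | 0 < f w}) ∧
      IsPreconnected (N ∩ {w | f w < 0}) := by
  have hr : f'.range = ⊤ := by
    apply LinearMap.range_eq_top.2
    apply LinearMap.surjective
    intro h
    exact hf' (by ext1 x; exact LinearMap.congr_fun h x)
  -- This chart makes `f` the first coordinate of a product; each half of a ball there is convex,
  -- hence connected.
  let e := hf.implicitToOpenPartialHomeomorph f f' hr
  have hea : e a = (0, 0) := by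
    rw [← ha]; exact hf.implicitToOpenPartialHomeomorph_self hr
  have hsrc : a ∈ e.source := hf.mem_implicitToOpenPartialHomeomorph_source hr
  have htgt : ((0, 0) : ℝ × f'.ker) ∈ e.target := hea ▸ e.map_source hsrc
  have hsymm : e.symm (0, 0) = a := by rw [← hea, e.left_inv hsrc]
  have hnhds : e.target ∩ e.symm ⁻¹' U ∈ 𝓝 ((0, 0) : ℝ × f'.ker) := by
    refine inter_mem (e.open_target.mem_nhds htgt) ?_
    apply (e.continuousAt_symm htgt).preimage_mem_nhds
    rwa [hsymm]
  obtain ⟨ε, hε, hball⟩ := Metric.mem_nhds_iff.1 hnhds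
  set B := Metric.ball ((0, 0) : ℝ × f'.ker) ε
  have hBt : B ⊆ e.target := fun p hp => (hball hp).1
  have hpre : ∀ T : Set ℝ, Convex ℝ T →
      IsPreconnected ((e.source ∩ e ⁻¹' B) ∩ {w | f w ∈ T}) := by
    intro T hT
    have h1 : (e.source ∩ e ⁻¹' B) ∩ {w | f w ∈ T} = e.symm '' (B ∩ Prod.fst ⁻¹' T) := by
      rw [e.symm_image_eq_source_inter_preimage (inter_subset_left.trans hBt), inter_assoc]
      rfl
    rw [h1]
    refine IsPreconnected.image ?_ _ (e.continuousOn_symm.mono (inter_subset_left.trans hBt))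
    exact ((convex_ball _ _).inter
      (hT.linear_preimage (LinearMap.fst ℝ ℝ f'.ker))).isPreconnected
  refine ⟨e.source ∩ e ⁻¹' B, ?_, e.isOpen_inter_preimage Metric.isOpen_ball, ⟨hsrc, ?_⟩,
    hpre (Ioi 0) (convex_Ioi 0), hpre (Iio 0) (convex_Iio 0)⟩
  · rintro w ⟨hw, hwB⟩
    have := (hball hwB).2
    rwa [mem_preimage, e.left_inv hw] at this
  · rw [mem_preimage, hea]
    exact Metric.mem_ball_self hε

theorem eval_smul_of_isHomogeneous {F : MvPolynomial (Fin 3) ℝ} {n : ℕ} (hF : F.IsHomogeneous n)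
    (r : ℝ) (v : Fin 3 → ℝ) : eval (r • v) F = r ^ n * eval v F := by
  rw [eval_eq, eval_eq, Finset.mul_sum]
  refine Finset.sum_congr rfl fun d hd => ?_
  have hd' : ∑ i, d i = n := by
    have := hF (mem_support_iff.1 hd)
    rw [Finsupp.weight_apply, Finsupp.sum_fintype _ _ (by simp)] at this
    simpa using this
  simp only [Pi.smul_apply, smul_eq_mul, mul_pow, Finset.prod_mul_distrib]
  rw [Finset.prod_pow_eq_pow_sum, Finset.sum_subset (Finset.subset_univ _)
    (fun i _ hi => by simpa using hi), hd']
  ring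

theorem toRP_mem_realPart {F : MvPolynomial (Fin 3) ℝ} {n : ℕ} (hF : F.IsHomogeneous n)
    {v : Fin 3 → ℝ} (hv : v ≠ 0) : toRP v ∈ realPart F ↔ eval v F = 0 := by
  obtain ⟨r, hr, h⟩ := exists_smul_of_toRP_eq hv (Projectivization.rep_nonzero (toRP v))
    (toRP_rep _).symm
  have : eval v F = r ^ n * eval (toRP v).rep F := by
    conv_lhs => rw [h]
    exact eval_smul_of_isHomogeneous hF _ _
  rw [this, mul_eq_zero_iff_left (pow_ne_zero _ hr)]
  rfl

/-- A nonsingular curve separates locally the inside of a disc bounded by a part of the curve from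
the outside. -/
theorem IsClosedDisc.exists_sign {F : MvPolynomial (Fin 3) ℝ} {n : ℕ} (hF : F.IsHomogeneous n)
    (hns : IsNonsingular F) {D O : Set RP2} (hD : IsClosedDisc D O) (hO : O ⊆ realPart F)
    {v : Fin 3 → ℝ} (hv : v ≠ 0) (hvO : toRP v ∈ O) :
    ∃ s : ℝ, s ≠ 0 ∧ ∀ᶠ w in 𝓝 v,
      (0 < s * eval w F → toRP w ∈ interior D) ∧ (s * eval w F < 0 → toRP w ∈ Dᶜ) := by
  have hv0 : eval v F = 0 := (toRP_mem_realPart hF hv).1 (hO hvO)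
  obtain ⟨i, hi⟩ := hns.exists_pderiv_ne_zero hv hv0
  have hF0 : F ≠ 0 := by rintro rfl; simp at hi
  have hf' : (∑ i, eval v (pderiv i F) •
      ContinuousLinearMap.proj (R := ℝ) (φ := fun _ : Fin 3 => ℝ) i) ≠ 0 := by
    intro h
    have := DFunLike.congr_fun h (Pi.single i 1)
    simp [Pi.single_apply] at this
    exact hi this
  obtain ⟨N, hN0, hNo, hvN, hpos, hneg⟩ := exists_isOpen_isPreconnected
    (hasStrictFDerivAt_eval F v) hf' hv0 (isOpen_ne.mem_nhds hv)
  have side : ∀ S : Set ℝ, (0 : ℝ) ∉ S → IsPreconnected (N ∩ {w | eval w F ∈ S}) →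
      (∀ w ∈ N, eval w F ∈ S → toRP w ∈ interior D) ∨ (∀ w ∈ N, eval w F ∈ S → toRP w ∈ Dᶜ) := by
    intro S hS hP
    have h1 : IsPreconnected (toRP '' (N ∩ {w | eval w F ∈ S})) :=
      hP.image _ (continuousOn_toRP.mono fun w hw => hN0 hw.1)
    have h2 : ∀ p ∈ toRP '' (N ∩ {w | eval w F ∈ S}), p ∉ O := by
      rintro _ ⟨w, ⟨hw, hwS⟩, rfl⟩ hwO
      have := (toRP_mem_realPart hF (hN0 hw)).1 (hO hwO)
      rw [mem_ofPred_eq, this] at hwS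
      exact hS hwS
    rcases hD.subset_or_subset h1 h2 with h | h
    · exact Or.inl fun w hw hwS => h ⟨w, ⟨hw, hwS⟩, rfl⟩
    · exact Or.inr fun w hw hwS => h ⟨w, ⟨hw, hwS⟩, rfl⟩
  have hmem : ∀ᶠ w in 𝓝 v, w ∈ N := hNo.mem_nhds hvN
  rcases side (Ioi 0) (by simp) hpos with h1 | h1 <;> rcases side (Iio 0) (by simp) hneg with h2 | h2
  -- With both sides inside, density of the points where F ≠ 0 and closedness of D put a whole
  -- neighbourhood of `v` in D, so `v` is not on the boundary.
  · exfalso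
    refine hD.not_mem_boundary_of_mem_interior (toRP_mem_interior hv ?_) hvO
    filter_upwards [hmem] with w hw
    by_contra hwD
    have h3 : ∀ᶠ x in 𝓝 w, toRP x ∈ Dᶜ :=
      (continuousAt_toRP (hN0 hw)).eventually (hD.isClosed.isOpen_compl.mem_nhds hwD)
    obtain ⟨x, hx0, hx1, hxN⟩ := ((frequently_eval_ne_zero hF0 w).and_eventually
      (h3.and (hNo.mem_nhds hw))).exists
    rcases lt_or_gt_of_ne hx0 with h | h
    · exact hx1 (interior_subset (h2 x hxN h))
    · exact hx1 (interior_subset (h1 x hxN h))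
  · refine ⟨1, one_ne_zero, ?_⟩
    filter_upwards [hmem] with w hw
    simp only [one_mul]
    exact ⟨h1 w hw, h2 w hw⟩
  · refine ⟨-1, by norm_num, ?_⟩
    filter_upwards [hmem] with w hw
    simp only [neg_mul, one_mul, Left.neg_pos_iff, Left.neg_neg_iff]
    exact ⟨h2 w hw, h1 w hw⟩
  -- With both sides outside, no interior points of D accumulate at `v`.
  · exfalso
    have h3 := hD.subset_closure_interior (hD.boundary_subset hvO)
    obtain ⟨_, ⟨w, ⟨hwN, hw0⟩, rfl⟩, hwD⟩ := mem_closure_iff.1 h3 _ (isOpen_image_toRP hNo)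
      ⟨v, ⟨hvN, hv⟩, rfl⟩
    have h4 : ∀ᶠ x in 𝓝 w, toRP x ∈ interior D :=
      (continuousAt_toRP hw0).eventually (isOpen_interior.mem_nhds hwD)
    obtain ⟨x, hx0, hx1, hxN⟩ := ((frequently_eval_ne_zero hF0 w).and_eventually
      (h4.and (hNo.mem_nhds hwN))).exists
    rcases lt_or_gt_of_ne hx0 with h | h
    · exact h2 x hxN h (interior_subset hx1)
    · exact h1 x hxN h (interior_subset hx1)


/-! ### Polynomial curves -/

/-- The point with parameter `u` of the polynomial curve `p` in `ℝ³`. -/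
def curvePt (p : Fin 3 → Polynomial ℝ) (u : ℝ) : Fin 3 → ℝ := fun i => (p i).eval u

theorem continuous_curvePt (p : Fin 3 → Polynomial ℝ) : Continuous (curvePt p) :=
  continuous_pi fun i => (p i).continuous

theorem eval_aeval_curve (p : Fin 3 → Polynomial ℝ) (F : MvPolynomial (Fin 3) ℝ) (u : ℝ) :
    (aeval p F).eval u = eval (curvePt p u) F := by
  induction F using MvPolynomial.induction_on with
  | C a => simp
  | add p q hp hq => simp [hp, hq]
  | mul_X q n hq => simp [hq, curvePt]

theorem natDegree_monomial_curve_le {p : Fin 3 → Polynomial ℝ} {k : ℕ}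
    (hp : ∀ i, (p i).natDegree ≤ k) (d : Fin 3 →₀ ℕ) :
    (∏ i, p i ^ d i).natDegree ≤ (∑ i, d i) * k := by
  rw [Finset.sum_mul]
  refine (Polynomial.natDegree_prod_le _ _).trans (Finset.sum_le_sum fun i _ => ?_)
  exact Polynomial.natDegree_pow_le_of_le _ (hp i)

theorem IsHomogeneous.sum_eq {F : MvPolynomial (Fin 3) ℝ} {n : ℕ} (hF : F.IsHomogeneous n)
    {d : Fin 3 →₀ ℕ} (hd : d ∈ F.support) : ∑ i, d i = n := by
  have := hF (mem_support_iff.1 hd)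
  rw [Finsupp.weight_apply, Finsupp.sum_fintype _ _ (by simp)] at this
  simpa using this

theorem aeval_curve_eq_sum (p : Fin 3 → Polynomial ℝ) (F : MvPolynomial (Fin 3) ℝ) :
    aeval p F = ∑ d ∈ F.support, Polynomial.C (coeff d F) * ∏ i, p i ^ d i := by
  rw [aeval_def, eval₂_eq']
  rfl

theorem natDegree_aeval_curve_le {F : MvPolynomial (Fin 3) ℝ} {n : ℕ} (hF : F.IsHomogeneous n)
    {p : Fin 3 → Polynomial ℝ} {k : ℕ} (hp : ∀ i, (p i).natDegree ≤ k) :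
    (aeval p F).natDegree ≤ n * k := by
  rw [aeval_curve_eq_sum]
  refine Polynomial.natDegree_sum_le_of_forall_le _ _ fun d hd => ?_
  refine (Polynomial.natDegree_C_mul_le _ _).trans ?_
  rw [← IsHomogeneous.sum_eq hF hd]
  exact natDegree_monomial_curve_le hp d

/-- The coefficient in the maximal degree is the value of F at the point at infinity, so the degree
drops when that point lies on F = 0. -/
theorem coeff_aeval_curve {F : MvPolynomial (Fin 3) ℝ} {n : ℕ} (hF : F.IsHomogeneous n)
    {p : Fin 3 → Polynomial ℝ} {k : ℕ} (hp : ∀ i, (p i).natDegree ≤ k) :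
    (aeval p F).coeff (n * k) = eval (fun i => (p i).coeff k) F := by
  rw [aeval_curve_eq_sum, Polynomial.finsetSum_coeff, eval_eq']
  refine Finset.sum_congr rfl fun d hd => ?_
  rw [Polynomial.coeff_C_mul, ← IsHomogeneous.sum_eq hF hd]
  congr 1
  have h3 : ∀ (a b c : Polynomial ℝ) (x y z : ℕ), a.natDegree ≤ x → b.natDegree ≤ y →
      c.natDegree ≤ z → (a * b * c).coeff (x + y + z) = a.coeff x * b.coeff y * c.coeff z := by
    intro a b c x y z ha hb hc
    rw [Polynomial.coeff_mul_add_eq_of_natDegree_le (Polynomial.natDegree_mul_le_of_le ha hb) hc,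
      Polynomial.coeff_mul_add_eq_of_natDegree_le ha hb]
  have hpow : ∀ i, (p i ^ d i).natDegree ≤ d i * k := fun i =>
    Polynomial.natDegree_pow_le_of_le _ (hp i)
  rw [Fin.prod_univ_three, Fin.prod_univ_three, Fin.sum_univ_three, add_mul, add_mul,
    h3 _ _ _ _ _ _ (hpow 0) (hpow 1) (hpow 2)]
  rw [Polynomial.coeff_pow_of_natDegree_le (hp 0), Polynomial.coeff_pow_of_natDegree_le (hp 1),
    Polynomial.coeff_pow_of_natDegree_le (hp 2)]

/-- The data of a polynomial curve in `ℝ³` which avoids the origin and has a point at infinity. -/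
structure IsProjCurve (p : Fin 3 → Polynomial ℝ) (k : ℕ) (q : Fin 3 → ℝ) : Prop where
  natDegree_le : ∀ i, (p i).natDegree ≤ k
  coeff_eq : ∀ i, (p i).coeff k = q i
  ne_zero : ∀ u, curvePt p u ≠ 0
  infty_ne_zero : q ≠ 0

namespace IsProjCurve

variable {p : Fin 3 → Polynomial ℝ} {k : ℕ} {q : Fin 3 → ℝ}

theorem continuous (h : IsProjCurve p k q) : Continuous fun u => toRP (curvePt p u) :=
  continuousOn_toRP.comp_continuous (continuous_curvePt p) h.ne_zero

/-- Up to the factor `u ^ k`, the curve is the one with reversed coefficients at parameter `u⁻¹`,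
which passes through `q` at 0. -/
theorem tendsto (h : IsProjCurve p k q) {l : Filter ℝ} (hl : Tendsto (fun u : ℝ => u⁻¹) l (𝓝 0))
    (hl0 : ∀ᶠ u in l, u ≠ 0) : Tendsto (fun u => toRP (curvePt p u)) l (𝓝 (toRP q)) := by
  let r : Fin 3 → Polynomial ℝ := fun i => (p i).reflect k
  have h0 : curvePt r 0 = q := by
    ext i
    simp only [curvePt, r]
    rw [← Polynomial.coeff_zero_eq_eval_zero, Polynomial.coeff_reflect, ← h.coeff_eq i,
      Polynomial.revAt_le (Nat.zero_le k), Nat.sub_zero]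
  have h1 : Tendsto (fun u => toRP (curvePt r u⁻¹)) l (𝓝 (toRP q)) := by
    have h2 : Tendsto (fun u : ℝ => curvePt r u⁻¹) l (𝓝 q) := by
      rw [← h0]
      exact ((continuous_curvePt r).tendsto 0).comp hl
    exact (continuousAt_toRP h.infty_ne_zero).tendsto.comp h2
  refine h1.congr' ?_
  filter_upwards [hl0] with u hu
  have : curvePt p u = u ^ k • curvePt r u⁻¹ := by
    ext i
    let := invertibleOfNonzero hu
    have := Polynomial.eval₂_reflect_mul_pow (RingHom.id ℝ) u k (p i) (h.natDegree_le i)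
    rw [invOf_eq_inv] at this
    simp only [curvePt, Pi.smul_apply, smul_eq_mul, r]
    rw [Polynomial.eval, ← this, mul_comm]
    rfl
  rw [this, toRP_smul (pow_ne_zero _ hu)]

theorem tendsto_atTop (h : IsProjCurve p k q) :
    Tendsto (fun u => toRP (curvePt p u)) atTop (𝓝 (toRP q)) :=
  h.tendsto tendsto_inv_atTop_zero (eventually_ne_atTop 0)

theorem tendsto_atBot (h : IsProjCurve p k q) :
    Tendsto (fun u => toRP (curvePt p u)) atBot (𝓝 (toRP q)) :=
  h.tendsto tendsto_inv_atBot_zero (eventually_ne_atBot 0)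

end IsProjCurve

/-! ### Crossing the boundary of a disc -/

theorem IsClosedDisc.exists_crossing {D O : Set RP2} (hD : IsClosedDisc D O) {γ : ℝ → RP2} {a b : ℝ}
    (hγ : ContinuousOn γ (uIcc a b)) (ha : γ a ∈ interior D) (hb : γ b ∈ Dᶜ) :
    ∃ u ∈ uIcc a b, u ≠ a ∧ u ≠ b ∧ γ u ∈ O := by
  by_contra! hcon
  have haO := hD.not_mem_boundary_of_mem_interior ha
  have hbO : γ b ∉ O := fun h => hb (hD.boundary_subset h)
  have : ∀ x ∈ γ '' uIcc a b, x ∉ O := by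
    rintro _ ⟨u, hu, rfl⟩
    by_cases h1 : u = a
    · rwa [h1]
    by_cases h2 : u = b
    · rwa [h2]
    exact hcon u hu h1 h2
  rcases hD.subset_or_subset (isPreconnected_uIcc.image γ hγ) this with h | h
  · exact hb (interior_subset (h ⟨b, right_mem_uIcc, rfl⟩))
  · exact h ⟨a, left_mem_uIcc, rfl⟩ (interior_subset ha)

/-- A closed curve in the projective plane with points inside and outside of a disc crosses the
boundary of the disc at least twice. -/
theorem IsClosedDisc.exists_two_crossings {D O : Set RP2} (hD : IsClosedDisc D O) {γ : ℝ → RP2}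
    {q : RP2} (hγ : Continuous γ) (htop : Tendsto γ atTop (𝓝 q)) (hbot : Tendsto γ atBot (𝓝 q))
    (hq : q ∉ O) (h1 : q ∈ interior D ∨ ∃ u, γ u ∈ interior D) (h2 : q ∈ Dᶜ ∨ ∃ u, γ u ∈ Dᶜ) :
    ∃ u u', u < u' ∧ γ u ∈ O ∧ γ u' ∈ O := by
  rcases hD.mem_trichotomy q with hqD | hqD | hqD
  -- Both ends of the curve tend to `q`, so there is one crossing on each side of the parameter `u`.
  -- The last case exchanges inside and outside.
  · obtain ⟨u, hu⟩ := h2.resolve_left fun h => h (interior_subset hqD)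
    obtain ⟨t, ht, hut⟩ := ((htop.eventually (isOpen_interior.mem_nhds hqD)).and
      (eventually_gt_atTop u)).exists
    obtain ⟨b, hb, hub⟩ := ((hbot.eventually (isOpen_interior.mem_nhds hqD)).and
      (eventually_lt_atBot u)).exists
    obtain ⟨t', ht', -, ht'2, ht'O⟩ := hD.exists_crossing hγ.continuousOn ht hu
    obtain ⟨b', hb', -, hb'2, hb'O⟩ := hD.exists_crossing hγ.continuousOn hb hu
    rw [uIcc_of_ge hut.le] at ht'
    rw [uIcc_of_le hub.le] at hb'
    exact ⟨b', t', (lt_of_le_of_ne hb'.2 hb'2).trans_le ht'.1, hb'O, ht'O⟩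
  · exact absurd hqD hq
  · obtain ⟨u, hu⟩ := h1.resolve_left fun h => hqD (interior_subset h)
    obtain ⟨t, ht, hut⟩ := ((htop.eventually (hD.isClosed.isOpen_compl.mem_nhds hqD)).and
      (eventually_gt_atTop u)).exists
    obtain ⟨b, hb, hub⟩ := ((hbot.eventually (hD.isClosed.isOpen_compl.mem_nhds hqD)).and
      (eventually_lt_atBot u)).exists
    obtain ⟨t', ht', ht'2, -, ht'O⟩ := hD.exists_crossing hγ.continuousOn hu ht
    obtain ⟨b', hb', hb'2, -, hb'O⟩ := hD.exists_crossing hγ.continuousOn hu hb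
    rw [uIcc_of_le hut.le] at ht'
    rw [uIcc_of_ge hub.le] at hb'
    exact ⟨b', t', (lt_of_le_of_ne hb'.2 hb'2).trans_le ht'.1, hb'O, ht'O⟩

/-! ### Ovals -/

section Ovals

variable {F : MvPolynomial (Fin 3) ℝ}

theorem ovals_subset_realPart (O : ovals F) : (O : Set RP2) ⊆ realPart F := by
  obtain ⟨⟨p, -, h⟩, -⟩ := O.2
  rw [h]
  exact connectedComponentIn_subset _ _

theorem ovals_eq_connectedComponentIn {O : ovals F} {p : RP2} (hp : p ∈ (O : Set RP2)) :
    (O : Set RP2) = connectedComponentIn (realPart F) p := by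
  obtain ⟨⟨q, -, h⟩, -⟩ := O.2
  rw [h] at hp ⊢
  exact connectedComponentIn_eq hp

/-- A connected part of the real part meets at most one oval. -/
theorem ovals_eq_of_isPreconnected {O₁ O₂ : ovals F} {P : Set RP2} (hP : IsPreconnected P)
    (hPF : P ⊆ realPart F) {p₁ p₂ : RP2} (h₁ : p₁ ∈ P) (h₁' : p₁ ∈ (O₁ : Set RP2)) (h₂ : p₂ ∈ P)
    (h₂' : p₂ ∈ (O₂ : Set RP2)) : O₁ = O₂ := by
  have : p₂ ∈ connectedComponentIn (realPart F) p₁ := hP.subset_connectedComponentIn h₁ hPF h₂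
  ext1
  rw [ovals_eq_connectedComponentIn h₁', ovals_eq_connectedComponentIn h₂',
    connectedComponentIn_eq this]

theorem ovals_eq_of_mem {O₁ O₂ : ovals F} {p : RP2} (h₁ : p ∈ (O₁ : Set RP2))
    (h₂ : p ∈ (O₂ : Set RP2)) : O₁ = O₂ :=
  ovals_eq_of_isPreconnected isPreconnected_singleton
    (singleton_subset_iff.2 (ovals_subset_realPart O₁ h₁)) rfl h₁ rfl h₂

theorem isPreconnected_oval (O : ovals F) : IsPreconnected (O : Set RP2) := by
  obtain ⟨⟨p, -, h⟩, -⟩ := O.2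
  rw [h]
  exact isPreconnected_connectedComponentIn

theorem oval_nonempty (O : ovals F) : (O : Set RP2).Nonempty := by
  obtain ⟨⟨p, hp, h⟩, -⟩ := O.2
  rw [h]
  exact ⟨p, mem_connectedComponentIn hp⟩

/-- If F vanished identically along the curve, the arc would join two different components of the
real part. -/
theorem aeval_curve_ne_zero {n : ℕ} (hF : F.IsHomogeneous n) {p : Fin 3 → Polynomial ℝ} {a b : ℝ}
    (hp : ∀ u ∈ uIcc a b, curvePt p u ≠ 0) {O₁ O₂ : ovals F} (hne : O₁ ≠ O₂)
    (ha : toRP (curvePt p a) ∈ (O₁ : Set RP2)) (hb : toRP (curvePt p b) ∈ (O₂ : Set RP2)) :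
    aeval p F ≠ 0 := by
  intro h
  apply hne
  have h1 : IsPreconnected ((fun u => toRP (curvePt p u)) '' uIcc a b) :=
    isPreconnected_uIcc.image _
      (continuousOn_toRP.comp (continuous_curvePt p).continuousOn hp)
  refine ovals_eq_of_isPreconnected h1 ?_ ⟨a, left_mem_uIcc, rfl⟩ ha ⟨b, right_mem_uIcc, rfl⟩ hb
  rintro _ ⟨u, hu, rfl⟩
  rw [toRP_mem_realPart hF (hp u hu), ← eval_aeval_curve, h, Polynomial.eval_zero]

/-- A choice of discs bounded by the ovals. -/
abbrev DiscChoice (D : ovals F → Set RP2) : Prop := ∀ O : ovals F, IsClosedDisc (D O) O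

open Classical in
/-- A polynomial curve with points inside and outside of every disc of a finite collection meets
every one of the boundary ovals at least twice. -/
theorem exists_finset_crossings {D : ovals F → Set RP2} (hD : DiscChoice D)
    {p : Fin 3 → Polynomial ℝ} {k : ℕ} {q : Fin 3 → ℝ} (hp : IsProjCurve p k q)
    (S : Finset (ovals F)) (hq : ∀ O ∈ S, toRP q ∉ (O : Set RP2))
    (h1 : ∀ O ∈ S, toRP q ∈ interior (D O) ∨ ∃ u, toRP (curvePt p u) ∈ interior (D O))
    (h2 : ∀ O ∈ S, toRP q ∈ (D O)ᶜ ∨ ∃ u, toRP (curvePt p u) ∈ (D O)ᶜ) :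
    ∃ Z : Finset ℝ, Z.card = 2 * S.card ∧
      ∀ u ∈ Z, ∃ O ∈ S, toRP (curvePt p u) ∈ (O : Set RP2) := by
  have key : ∀ O : S, ∃ u u', u < u' ∧ toRP (curvePt p u) ∈ ((O : ovals F) : Set RP2) ∧
      toRP (curvePt p u') ∈ ((O : ovals F) : Set RP2) := fun O =>
    (hD O).exists_two_crossings hp.continuous hp.tendsto_atTop hp.tendsto_atBot
      (hq O O.2) (h1 O O.2) (h2 O O.2)
  choose a b hab ha hb using key
  refine ⟨S.attach.biUnion fun O => {a O, b O}, ?_, ?_⟩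
  · rw [Finset.card_biUnion, Finset.sum_congr rfl fun O _ => Finset.card_pair (hab O).ne]
    · simp [mul_comm]
    · intro O _ O' _ hne
      rw [Function.onFun, Finset.disjoint_left]
      intro u hu hu'
      apply hne
      simp only [Finset.mem_insert, Finset.mem_singleton] at hu hu'
      ext1
      rcases hu with rfl | rfl <;> rcases hu' with h | h
      · exact ovals_eq_of_mem (ha O) (h ▸ ha O')
      · exact ovals_eq_of_mem (ha O) (h ▸ hb O')
      · exact ovals_eq_of_mem (hb O) (h ▸ ha O')
      · exact ovals_eq_of_mem (hb O) (h ▸ hb O')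
  · intro u hu
    simp only [Finset.mem_biUnion, Finset.mem_attach, Finset.mem_insert, Finset.mem_singleton,
      true_and] at hu
    obtain ⟨O, rfl | rfl⟩ := hu
    · exact ⟨O, O.2, ha O⟩
    · exact ⟨O, O.2, hb O⟩

end Ovals


/-! ### Projective lines -/

/-- The vectors `a`, `b` span a plane of `ℝ³`, i.e. a projective line. -/
def SpansLine (a b : Fin 3 → ℝ) : Prop :=
  ∀ s t : ℝ, s • a + t • b = 0 → s = 0 ∧ t = 0

/-- The projective line spanned by two vectors. -/
def projLine (a b : Fin 3 → ℝ) : Set RP2 :=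
  {P | ∃ s t : ℝ, s • a + t • b ≠ 0 ∧ toRP (s • a + t • b) = P}

theorem SpansLine.of_toRP_ne {a b : Fin 3 → ℝ} (ha : a ≠ 0) (hb : b ≠ 0) (h : toRP a ≠ toRP b) :
    SpansLine a b := by
  intro s t hst
  have hs : s = 0 := by
    by_contra hs
    have ht : t ≠ 0 := by
      rintro rfl
      simp [hs, ha] at hst
    apply h
    rw [← toRP_smul hs, eq_neg_of_add_eq_zero_left hst, ← neg_smul, toRP_smul (neg_ne_zero.2 ht)]
  subst hs
  simpa [hb] using hst

theorem exists_toRP_ne (P : RP2) : ∃ v : Fin 3 → ℝ, v ≠ 0 ∧ toRP v ≠ P := by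
  by_cases h : toRP (Pi.single 0 1) = P
  · refine ⟨Pi.single 1 1, by simp, ?_⟩
    rw [← h]
    intro h'
    obtain ⟨r, -, hr⟩ := exists_smul_of_toRP_eq (by simp) (by simp) h'
    simpa using congrFun hr 1
  · exact ⟨Pi.single 0 1, by simp, h⟩

theorem exists_projLine (P Q : RP2) :
    ∃ a b : Fin 3 → ℝ, SpansLine a b ∧ P ∈ projLine a b ∧ Q ∈ projLine a b := by
  have hP : P.rep ≠ 0 := P.rep_nonzero
  have hmem : ∀ b, P ∈ projLine P.rep b := fun b =>
    ⟨1, 0, by simpa using hP, by simpa using toRP_rep P⟩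
  by_cases h : P = Q
  · subst h
    obtain ⟨v, hv, hvP⟩ := exists_toRP_ne P
    refine ⟨P.rep, v, .of_toRP_ne hP hv ?_, hmem v, hmem v⟩
    rw [toRP_rep]
    exact hvP.symm
  · refine ⟨P.rep, Q.rep, .of_toRP_ne hP Q.rep_nonzero ?_, hmem _, 0, 1, ?_, ?_⟩
    · rwa [toRP_rep, toRP_rep]
    · simpa using Q.rep_nonzero
    · simpa using toRP_rep Q

theorem isPreconnected_projLine {a b : Fin 3 → ℝ} (hab : SpansLine a b) :
    IsPreconnected (projLine a b) := by
  have h0 : ∀ θ : ℝ, Real.cos θ • a + Real.sin θ • b ≠ 0 := by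
    intro θ h
    obtain ⟨h1, h2⟩ := hab _ _ h
    have := Real.sin_sq_add_cos_sq θ
    rw [h1, h2] at this
    norm_num at this
  have h1 : projLine a b = range fun θ : ℝ => toRP (Real.cos θ • a + Real.sin θ • b) := by
    apply Subset.antisymm
    · rintro _ ⟨s, t, hst, rfl⟩
      -- The angle comes from polar coordinates of s + it.
      have hne : (⟨s, t⟩ : ℂ) ≠ 0 := by
        intro h
        rw [Complex.ext_iff] at h
        simp only [Complex.zero_re, Complex.zero_im] at h
        apply hst
        rw [h.1, h.2, zero_smul, zero_smul, add_zero]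
      refine ⟨Complex.arg ⟨s, t⟩, ?_⟩
      have hn : ‖(⟨s, t⟩ : ℂ)‖ ≠ 0 := norm_ne_zero_iff.2 hne
      change toRP _ = _
      rw [← toRP_smul hn, smul_add, smul_smul, smul_smul, Complex.norm_mul_cos_arg,
        Complex.norm_mul_sin_arg]
    · rintro _ ⟨θ, rfl⟩
      exact ⟨_, _, h0 θ, rfl⟩
  rw [h1]
  exact isPreconnected_range (continuousOn_toRP.comp_continuous (by fun_prop) h0)

/-- The line is connected and is not contained in the disc. -/
theorem IsClosedDisc.exists_mem_line {D O : Set RP2} (hD : IsClosedDisc D O) {a b : Fin 3 → ℝ}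
    (hab : SpansLine a b) {P : RP2} (hP : P ∈ projLine a b) (hPD : P ∈ interior D) :
    ∃ Q ∈ projLine a b, Q ∈ O := by
  by_contra! hcon
  obtain ⟨s, t, hst, hD'⟩ := hD.exists_not_mem_of_line hab
  rcases hD.subset_or_subset (isPreconnected_projLine hab) hcon with h | h
  · exact hD' (interior_subset (h ⟨s, t, hst, rfl⟩))
  · exact h hP (interior_subset hPD)

/-- The affine parametrization of a projective line, with the point `q` at infinity. -/
def linePoly (b q : Fin 3 → ℝ) : Fin 3 → Polynomial ℝ :=
  fun i => Polynomial.C (b i) + Polynomial.C (q i) * Polynomial.X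

theorem curvePt_linePoly (b q : Fin 3 → ℝ) (u : ℝ) : curvePt (linePoly b q) u = b + u • q := by
  ext i
  simp [curvePt, linePoly, mul_comm u]

theorem isProjCurve_linePoly {b q : Fin 3 → ℝ} (h : SpansLine b q) :
    IsProjCurve (linePoly b q) 1 q where
  natDegree_le i := by
    unfold linePoly
    compute_degree
  coeff_eq i := by simp [linePoly, Polynomial.coeff_C]
  ne_zero u hu := by
    rw [curvePt_linePoly] at hu
    exact one_ne_zero (h 1 u (by rwa [one_smul])).1
  infty_ne_zero hq := one_ne_zero (h 0 1 (by simp [hq])).2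

/-! ### Lines through several ovals, and non-nesting of the discs. -/

section Ovals

variable {F : MvPolynomial (Fin 3) ℝ}

open Classical in
theorem card_le_of_forall_root {g : Polynomial ℝ} (hg : g ≠ 0) {n : ℕ} (hn : g.natDegree ≤ n)
    {Z : Finset ℝ} (hZ : ∀ u ∈ Z, g.eval u = 0) : Z.card ≤ n := by
  have h1 : Z ⊆ g.roots.toFinset := fun u hu => by
    rw [Multiset.mem_toFinset, Polynomial.mem_roots hg]
    exact hZ u hu
  exact (Finset.card_le_card h1).trans ((Multiset.toFinset_card_le _).trans
    ((Polynomial.card_roots' g).trans hn))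

open Classical in
/-- A projective line does not meet the interiors of three ovals of a quintic. -/
theorem not_three_on_line (hF : F.IsHomogeneous 5) {D : ovals F → Set RP2} (hD : DiscChoice D)
    {a b : Fin 3 → ℝ} (hab : SpansLine a b) {O₁ O₂ O₃ : ovals F} (h12 : O₁ ≠ O₂) (h13 : O₁ ≠ O₃)
    (h23 : O₂ ≠ O₃) {P₁ P₂ P₃ : RP2} (hL₁ : P₁ ∈ projLine a b) (hL₂ : P₂ ∈ projLine a b)
    (hL₃ : P₃ ∈ projLine a b) (hP₁ : P₁ ∈ interior (D O₁)) (hP₂ : P₂ ∈ interior (D O₂))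
    (hP₃ : P₃ ∈ interior (D O₃)) : False := by
  -- A point of the line off the curve is placed at infinity, so that no intersection is lost there.
  obtain ⟨s₀, t₀, hq0, hqF⟩ : ∃ s t : ℝ, s • a + t • b ≠ 0 ∧ eval (s • a + t • b) F ≠ 0 := by
    by_contra! hcon
    obtain ⟨Q₁, hQ₁, hQ₁'⟩ := (hD O₁).exists_mem_line hab hL₁ hP₁
    obtain ⟨Q₂, hQ₂, hQ₂'⟩ := (hD O₂).exists_mem_line hab hL₂ hP₂
    refine h12 (ovals_eq_of_isPreconnected (isPreconnected_projLine hab) ?_ hQ₁ hQ₁' hQ₂ hQ₂')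
    rintro _ ⟨s, t, hst, rfl⟩
    exact (toRP_mem_realPart hF hst).2 (hcon s t hst)
  set q := s₀ • a + t₀ • b with hq
  have hN : s₀ ^ 2 + t₀ ^ 2 ≠ 0 := by
    intro h
    apply hq0
    rw [hq, show s₀ = 0 by nlinarith [sq_nonneg s₀, sq_nonneg t₀],
      show t₀ = 0 by nlinarith [sq_nonneg s₀, sq_nonneg t₀]]
    simp
  -- The coefficient vector (-t₀, s₀) is (s₀, t₀) turned by a right angle.
  have hb'q : SpansLine ((-t₀) • a + s₀ • b) q := by
    intro α β h
    rw [hq] at h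
    obtain ⟨e1, e2⟩ := hab (-α * t₀ + β * s₀) (α * s₀ + β * t₀) (by rw [← h]; module)
    constructor
    · apply (mul_eq_zero_iff_right hN).1
      linear_combination -t₀ * e1 + s₀ * e2
    · apply (mul_eq_zero_iff_right hN).1
      linear_combination s₀ * e1 + t₀ * e2
  have hp := isProjCurve_linePoly hb'q
  have hpar : ∀ P ∈ projLine a b, toRP q = P ∨
      ∃ u, toRP (curvePt (linePoly ((-t₀) • a + s₀ • b) q) u) = P := by
    rintro _ ⟨s, t, hst, rfl⟩
    have h1 : (s₀ ^ 2 + t₀ ^ 2) • (s • a + t • b) =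
        (-s * t₀ + t * s₀) • ((-t₀) • a + s₀ • b) + (s * s₀ + t * t₀) • q := by
      rw [hq]; module
    rw [← toRP_smul (v := s • a + t • b) hN, h1]
    by_cases hα : -s * t₀ + t * s₀ = 0
    · left
      rw [hα, zero_smul, zero_add, toRP_smul]
      intro hβ
      rw [hα, hβ, zero_smul, zero_smul, add_zero] at h1
      exact (smul_ne_zero hN hst) h1
    · right
      refine ⟨(s * s₀ + t * t₀) / (-s * t₀ + t * s₀), ?_⟩
      rw [curvePt_linePoly, ← toRP_smul hα, smul_add, smul_smul, mul_div_cancel₀ _ hα]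
  have hint : ∀ {O : ovals F} {P : RP2}, P ∈ projLine a b → P ∈ interior (D O) →
      toRP q ∈ interior (D O) ∨
        ∃ u, toRP (curvePt (linePoly ((-t₀) • a + s₀ • b) q) u) ∈ interior (D O) := by
    intro O P hL hP
    rcases hpar P hL with rfl | ⟨u, rfl⟩
    · exact Or.inl hP
    · exact Or.inr ⟨u, hP⟩
  obtain ⟨Z, hZ, hZO⟩ := exists_finset_crossings hD hp {O₁, O₂, O₃}
    (fun O _ h => hqF ((toRP_mem_realPart hF hq0).1 (ovals_subset_realPart O h)))
    (by
      intro O hO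
      simp only [Finset.mem_insert, Finset.mem_singleton] at hO
      rcases hO with rfl | rfl | rfl
      exacts [hint hL₁ hP₁, hint hL₂ hP₂, hint hL₃ hP₃])
    (by
      intro O hO
      obtain ⟨s, t, hst, h⟩ := (hD O).exists_not_mem_of_line hab
      rcases hpar _ ⟨s, t, hst, rfl⟩ with h' | ⟨u, h'⟩
      · exact Or.inl (h' ▸ h)
      · exact Or.inr ⟨u, h' ▸ h⟩)
  have hcard : ({O₁, O₂, O₃} : Finset (ovals F)).card = 3 :=
    Finset.card_eq_three.2 ⟨_, _, _, h12, h13, h23, rfl⟩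
  have hg : aeval (linePoly ((-t₀) • a + s₀ • b) q) F ≠ 0 := by
    intro h
    have := coeff_aeval_curve hF hp.natDegree_le
    rw [h, Polynomial.coeff_zero] at this
    apply hqF
    rw [this]
    congr 2
    exact (funext hp.coeff_eq).symm
  -- Six distinct roots against degree at most five.
  have := card_le_of_forall_root hg (natDegree_aeval_curve_le hF hp.natDegree_le) (Z := Z) (by
    intro u hu
    obtain ⟨O, -, h⟩ := hZO u hu
    rw [eval_aeval_curve]
    exact (toRP_mem_realPart hF (hp.ne_zero u)).1 (ovals_subset_realPart O h))
  omega

/-- The discs of the ovals of a quintic with at least three ovals are not nested. -/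
theorem not_mem_disc (hF : F.IsHomogeneous 5) {D : ovals F → Set RP2} (hD : DiscChoice D)
    {x : ovals F → RP2} (hx : ∀ O, x O ∈ interior (D O)) {O₁ O₂ O₃ : ovals F} (h12 : O₁ ≠ O₂)
    (h13 : O₁ ≠ O₃) (h23 : O₂ ≠ O₃) : x O₁ ∉ D O₂ := by
  intro hmem
  have hd : ∀ O O' : ovals F, O ≠ O' → ∀ p ∈ (O : Set RP2), p ∉ (O' : Set RP2) :=
    fun O O' hne p h h' => hne (ovals_eq_of_mem h h')
  -- The line through `x O` and `x O₃` meets O, hence the inside of O' as well: three ovals on a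
  -- line.
  have nest : ∀ O O' : ovals F, O ≠ O' → O ≠ O₃ → O' ≠ O₃ → ¬ (O : Set RP2) ⊆ interior (D O') := by
    intro O O' h1 h2 h3 hsub
    obtain ⟨a, b, hab, hP, hQ⟩ := exists_projLine (x O) (x O₃)
    obtain ⟨R, hRL, hRO⟩ := (hD O).exists_mem_line hab hP (hx O)
    exact not_three_on_line hF hD hab h1 h2 h3 hP hRL hQ (hx O) (hsub hRO) (hx O₃)
  have c1 := ((hD O₂).subset_or_subset (isPreconnected_oval O₁) (hd _ _ h12)).resolve_left
    (nest _ _ h12 h13 h23)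
  have c2 := ((hD O₁).subset_or_subset (isPreconnected_oval O₂) (hd _ _ h12.symm)).resolve_left
    (nest _ _ h12.symm h23 h13)
  rcases (hD O₂).subset_or_subset (hD O₁).isPreconnected (fun p hp h => c2 h hp) with h | h
  · obtain ⟨p, hp⟩ := oval_nonempty O₁
    exact c1 hp (interior_subset (h ((hD O₁).boundary_subset hp)))
  · exact h (interior_subset (hx O₁)) hmem

end Ovals


/-! ### Signs along curves that avoid the pseudoline -/

section Ovals

variable {F : MvPolynomial (Fin 3) ℝ}

open Classical in
/-- The parity, as a sign, of the number of the discs of `S` outside of which the point lies. -/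
def sideSign (D : ovals F → Set RP2) (S : Finset (ovals F)) (v : Fin 3 → ℝ) : ℝ :=
  ∏ O ∈ S, if toRP v ∈ interior (D O) then 1 else -1

theorem sideSign_ne_zero (D : ovals F → Set RP2) (S : Finset (ovals F)) (v : Fin 3 → ℝ) :
    sideSign D S v ≠ 0 := by
  unfold sideSign
  refine Finset.prod_ne_zero_iff.2 fun O _ => ?_
  split_ifs <;> norm_num

theorem IsClosedDisc.eventually_mem_interior_iff {D O : Set RP2} (hD : IsClosedDisc D O)
    {v : Fin 3 → ℝ} (hv : v ≠ 0) (h : toRP v ∉ O) :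
    ∀ᶠ w in 𝓝 v, (toRP w ∈ interior D ↔ toRP v ∈ interior D) := by
  rcases hD.mem_trichotomy (toRP v) with h1 | h1 | h1
  · filter_upwards [(continuousAt_toRP hv).eventually (isOpen_interior.mem_nhds h1)] with w hw
    exact iff_of_true hw h1
  · exact absurd h1 h
  · filter_upwards [(continuousAt_toRP hv).eventually (hD.isClosed.isOpen_compl.mem_nhds h1)]
      with w hw
    exact iff_of_false (fun h' => hw (interior_subset h')) (fun h' => h1 (interior_subset h'))

theorem eventually_sideSign_eq {D : ovals F → Set RP2} (hD : DiscChoice D) {S : Finset (ovals F)}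
    {v : Fin 3 → ℝ} (hv : v ≠ 0) (h : ∀ O ∈ S, toRP v ∉ (O : Set RP2)) :
    ∀ᶠ w in 𝓝 v, sideSign D S w = sideSign D S v := by
  classical
  have : ∀ᶠ w in 𝓝 v, ∀ O ∈ S, (toRP w ∈ interior (D O) ↔ toRP v ∈ interior (D O)) :=
    (Filter.eventually_all_finset S).2 fun O hO => (hD O).eventually_mem_interior_iff hv (h O hO)
  filter_upwards [this] with w hw
  refine Finset.prod_congr rfl fun O hO => ?_
  exact if_congr (hw O hO) rfl rfl

theorem sideSign_of_mem_interior {D : ovals F → Set RP2} {S : Finset (ovals F)} {v : Fin 3 → ℝ}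
    {O : ovals F} (hO : O ∈ S) (h : toRP v ∈ interior (D O))
    (h' : ∀ O', O' ≠ O → toRP v ∉ D O') : sideSign D S v = (-1) ^ (S.card - 1) := by
  classical
  unfold sideSign
  rw [← Finset.mul_prod_erase S _ hO, if_pos h, one_mul, ← Finset.card_erase_of_mem hO,
    ← Finset.prod_const]
  exact Finset.prod_congr rfl fun O' hO' =>
    if_neg fun h'' => h' O' (Finset.ne_of_mem_erase hO') (interior_subset h'')

/-- At a point of an oval of `S`, F and the factor of that oval change sign together while the other
factors are locally constant. Away from the curve every factor is locally constant. -/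
theorem exists_sign_mul_sideSign {n : ℕ} (hF : F.IsHomogeneous n) (hns : IsNonsingular F)
    {D : ovals F → Set RP2} (hD : DiscChoice D) {S : Finset (ovals F)} {v : Fin 3 → ℝ} (hv : v ≠ 0)
    (h : eval v F = 0 → ∃ O ∈ S, toRP v ∈ (O : Set RP2)) :
    ∃ s : ℝ, s ≠ 0 ∧ ∀ᶠ w in 𝓝 v, eval w F ≠ 0 → 0 < s * (eval w F * sideSign D S w) := by
  classical
  by_cases hv0 : eval v F = 0
  · obtain ⟨O, hO, hvO⟩ := h hv0
    obtain ⟨s, hs, hsv⟩ := (hD O).exists_sign hF hns (ovals_subset_realPart O) hv hvO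
    have hc := sideSign_ne_zero D (S.erase O) v
    refine ⟨s * sideSign D (S.erase O) v, mul_ne_zero hs hc, ?_⟩
    filter_upwards [hsv, eventually_sideSign_eq hD (S := S.erase O) hv fun O' hO' h' =>
      Finset.ne_of_mem_erase hO' (ovals_eq_of_mem h' hvO)] with w hw hw' hw0
    have h1 : sideSign D S w =
        (if toRP w ∈ interior (D O) then 1 else -1) * sideSign D (S.erase O) v := by
      rw [← hw']
      exact (Finset.mul_prod_erase S _ hO).symm
    have h2 : 0 < sideSign D (S.erase O) v ^ 2 := by positivity
    rw [h1]
    rcases lt_or_gt_of_ne (mul_ne_zero hs hw0) with h3 | h3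
    · rw [if_neg fun h' => hw.2 h3 (interior_subset h')]
      nlinarith
    · rw [if_pos (hw.1 h3)]
      nlinarith
  · have hc := sideSign_ne_zero D S v
    refine ⟨eval v F * sideSign D S v, mul_ne_zero hv0 hc, ?_⟩
    have h1 : ∀ᶠ w in 𝓝 v, 0 < eval v F * eval w F :=
      (continuous_const.mul (continuous_eval_mv F)).continuousAt.eventually
        (lt_mem_nhds (mul_self_pos.2 hv0))
    filter_upwards [h1, eventually_sideSign_eq hD (S := S) hv fun O _ h' =>
      hv0 ((toRP_mem_realPart hF hv).1 (ovals_subset_realPart O h'))] with w hw hw' _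
    rw [hw']
    have h2 : 0 < sideSign D S v ^ 2 := by positivity
    nlinarith

/-- If a curve joins interior points of two non-nested ovals and has no common points with the
non-oval part of the curve `F = 0`, then `F` has the same sign at its endpoints. -/
theorem eval_mul_eval_pos {n : ℕ} (hF : F.IsHomogeneous n) (hns : IsNonsingular F)
    {D : ovals F → Set RP2} (hD : DiscChoice D) {p : Fin 3 → Polynomial ℝ} {a b : ℝ}
    (hp : ∀ u ∈ uIcc a b, curvePt p u ≠ 0) (hg : aeval p F ≠ 0)
    (hz : ∀ u ∈ uIcc a b, eval (curvePt p u) F = 0 →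
      ∃ O : ovals F, toRP (curvePt p u) ∈ (O : Set RP2))
    {Oa Ob : ovals F} (ha : toRP (curvePt p a) ∈ interior (D Oa))
    (ha' : ∀ O, O ≠ Oa → toRP (curvePt p a) ∉ D O) (hb : toRP (curvePt p b) ∈ interior (D Ob))
    (hb' : ∀ O, O ≠ Ob → toRP (curvePt p b) ∉ D O) :
    0 < eval (curvePt p a) F * eval (curvePt p b) F := by
  classical
  have end_ne : ∀ {u : ℝ} {Ou : ovals F}, u ∈ uIcc a b → toRP (curvePt p u) ∈ interior (D Ou) →
      (∀ O, O ≠ Ou → toRP (curvePt p u) ∉ D O) → eval (curvePt p u) F ≠ 0 := by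
    intro u Ou hu hi ho h0
    obtain ⟨O, hO⟩ := hz u hu h0
    by_cases h : O = Ou
    · exact (hD Ou).not_mem_boundary_of_mem_interior hi (h ▸ hO)
    · exact ho O h ((hD O).boundary_subset hO)
  let φ : ℝ → ovals F := fun u =>
    if h : ∃ O : ovals F, toRP (curvePt p u) ∈ (O : Set RP2) then h.choose else Oa
  -- Finitely many ovals suffice: one for each root, which covers every oval met at a zero on the
  -- arc. `Oa` and `Ob` are added so that each endpoint lies in exactly one disc of `S`, which makes
  -- the two side signs equal.
  let S : Finset (ovals F) := insert Oa (insert Ob ((aeval p F).roots.toFinset.image φ))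
  have hS : ∀ u ∈ uIcc a b, eval (curvePt p u) F = 0 →
      ∃ O ∈ S, toRP (curvePt p u) ∈ (O : Set RP2) := by
    intro u hu h0
    have h := hz u hu h0
    refine ⟨φ u, ?_, ?_⟩
    · refine Finset.mem_insert_of_mem (Finset.mem_insert_of_mem (Finset.mem_image_of_mem _ ?_))
      rw [Multiset.mem_toFinset, Polynomial.mem_roots hg, Polynomial.IsRoot, eval_aeval_curve, h0]
    · simp only [φ, dif_pos h]
      exact h.choose_spec
  let H : ℝ → ℝ := fun u => eval (curvePt p u) F * sideSign D S (curvePt p u)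
  -- `A` and `B` are open and cover the interval. They are disjoint because the zeros are isolated,
  -- so connectedness leaves only one of them.
  let A : Set ℝ := {t | ∀ᶠ u in 𝓝 t, eval (curvePt p u) F ≠ 0 → 0 < H u}
  let B : Set ℝ := {t | ∀ᶠ u in 𝓝 t, eval (curvePt p u) F ≠ 0 → H u < 0}
  have hAB : Disjoint A B := by
    rw [Set.disjoint_left]
    intro t htA htB
    have h1 : ∀ᶠ u in 𝓝[≠] t, eval (curvePt p u) F ≠ 0 := by
      have h2 : ((aeval p F).roots.toFinset : Set ℝ)ᶜ ∈ 𝓝[≠] t :=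
        nhdsNE_le_cofinite t (Finset.finite_toSet _).compl_mem_cofinite
      filter_upwards [h2] with u hu h0
      apply hu
      rw [Finset.mem_coe, Multiset.mem_toFinset, Polynomial.mem_roots hg, Polynomial.IsRoot,
        eval_aeval_curve, h0]
    have htA' : ∀ᶠ u in 𝓝 t, eval (curvePt p u) F ≠ 0 → 0 < H u := htA
    have htB' : ∀ᶠ u in 𝓝 t, eval (curvePt p u) F ≠ 0 → H u < 0 := htB
    obtain ⟨u, hu, huA, huB⟩ := (h1.and (eventually_nhdsWithin_of_eventually_nhds
      (htA'.and htB'))).exists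
    exact lt_asymm (huA hu) (huB hu)
  have hcover : uIcc a b ⊆ A ∪ B := by
    intro t ht
    obtain ⟨s, hs, h⟩ := exists_sign_mul_sideSign hF hns hD (hp t ht) (hS t ht)
    have h' := (continuous_curvePt p).continuousAt.eventually h
    rcases lt_or_gt_of_ne hs with hs | hs
    · refine Or.inr (h'.mono fun u hu h0 => ?_)
      exact (pos_iff_pos_of_mul_pos (neg_mul_neg s (H u) ▸ hu h0 : 0 < -s * -H u)).1
        (neg_pos.2 hs) |> neg_pos.1
    · exact Or.inl (h'.mono fun u hu h0 => (mul_pos_iff_of_pos_left hs).1 (hu h0))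
  have key : 0 < H a * H b := by
    have ha0 := end_ne left_mem_uIcc ha ha'
    have hb0 := end_ne right_mem_uIcc hb hb'
    rcases isPreconnected_uIcc.subset_or_subset isOpen_setOfPred_eventually_nhds
      isOpen_setOfPred_eventually_nhds hAB hcover with h | h
    · exact mul_pos ((h left_mem_uIcc : ∀ᶠ u in 𝓝 a, _).self_of_nhds ha0)
        ((h right_mem_uIcc : ∀ᶠ u in 𝓝 b, _).self_of_nhds hb0)
    · exact mul_pos_of_neg_of_neg ((h left_mem_uIcc : ∀ᶠ u in 𝓝 a, _).self_of_nhds ha0)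
        ((h right_mem_uIcc : ∀ᶠ u in 𝓝 b, _).self_of_nhds hb0)
  have e1 : sideSign D S (curvePt p a) = (-1) ^ (S.card - 1) :=
    sideSign_of_mem_interior (by simp [S]) ha ha'
  have e2 : sideSign D S (curvePt p b) = (-1) ^ (S.card - 1) :=
    sideSign_of_mem_interior (by simp [S]) hb hb'
  simp only [H, e1, e2] at key
  have h1 : ((-1 : ℝ) ^ (S.card - 1)) * (-1) ^ (S.card - 1) = 1 := by
    rw [← mul_pow]; norm_num
  calc (0 : ℝ) < _ := key
    _ = eval (curvePt p a) F * eval (curvePt p b) F *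
        (((-1 : ℝ) ^ (S.card - 1)) * (-1) ^ (S.card - 1)) := by ring
    _ = _ := by rw [h1, mul_one]

end Ovals


section Ovals

variable {F : MvPolynomial (Fin 3) ℝ}

/-! ### The segments determined by a quintic -/

theorem restrictToLine_eq (F : MvPolynomial (Fin 3) ℝ) (v₁ v₂ : Fin 3 → ℝ) :
    restrictToLine F v₁ v₂ = aeval (linePoly v₁ (v₂ - v₁)) F := by
  unfold restrictToLine linePoly
  congr 2
  ext1 i
  rw [Pi.sub_apply, Polynomial.C_sub]
  ring

theorem mem_pseudoline_iff {p : RP2} (hp : p ∈ realPart F) :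
    p ∈ pseudoline F ↔ ¬ ∃ O : ovals F, p ∈ (O : Set RP2) := by
  have : IsOval F (connectedComponentIn (realPart F) p) ↔ ∃ O : ovals F, p ∈ (O : Set RP2) := by
    constructor
    · exact fun h => ⟨⟨_, h⟩, mem_connectedComponentIn hp⟩
    · rintro ⟨O, hO⟩
      rw [← ovals_eq_connectedComponentIn hO]
      exact O.2
  rw [← this]
  exact and_iff_right hp

theorem natDegree_le_of_coeff_eq_zero {g : Polynomial ℝ} {n : ℕ} (h : g.natDegree ≤ n + 1)
    (h0 : g.coeff (n + 1) = 0) : g.natDegree ≤ n := by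
  rw [Polynomial.natDegree_le_iff_coeff_eq_zero]
  intro N hN
  rcases (Nat.succ_le_of_lt hN).eq_or_lt with rfl | hN
  · exact h0
  · exact Polynomial.coeff_eq_zero_of_natDegree_lt (h.trans_lt hN)

open Classical in
/-- All but at most one of the real intersection points of a quintic with a line crossing two
ovals lie on ovals. -/
theorem exists_finset_roots_line (hF : F.IsHomogeneous 5) {D : ovals F → Set RP2}
    (hD : DiscChoice D) {b q : Fin 3 → ℝ} (hp : IsProjCurve (linePoly b q) 1 q)
    {O₁ O₂ : ovals F} (h12 : O₁ ≠ O₂)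
    {u₁ u₂ : ℝ} (h1 : ∀ O, O = O₁ ∨ O = O₂ → ∃ u, toRP (curvePt (linePoly b q) u) ∈ interior (D O))
    (h2 : ∀ O, O = O₁ ∨ O = O₂ → ∃ u, toRP (curvePt (linePoly b q) u) ∈ (D O)ᶜ)
    (hu₁ : toRP (curvePt (linePoly b q) u₁) ∈ (O₁ : Set RP2))
    (hu₂ : toRP (curvePt (linePoly b q) u₂) ∈ (O₂ : Set RP2)) :
    ∃ Z : Finset ℝ, (aeval (linePoly b q) F).natDegree ≤ Z.card + 1 ∧
      ∀ u ∈ Z, ∃ O : ovals F, toRP (curvePt (linePoly b q) u) ∈ (O : Set RP2) := by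
  have hdeg := natDegree_aeval_curve_le hF hp.natDegree_le
  have hq : (linePoly b q · |>.coeff 1) = q := funext hp.coeff_eq
  -- If the point at infinity lies on one oval, the degree is at most 4. The two crossings of the
  -- other oval and one finite point of the first still leave at most one root.
  have hinf : ∀ O O' : ovals F, (O = O₁ ∧ O' = O₂ ∨ O = O₂ ∧ O' = O₁) → ∀ u,
      toRP (curvePt (linePoly b q) u) ∈ (O : Set RP2) → toRP q ∈ (O : Set RP2) →
      ∃ Z : Finset ℝ, (aeval (linePoly b q) F).natDegree ≤ Z.card + 1 ∧
        ∀ u ∈ Z, ∃ O : ovals F, toRP (curvePt (linePoly b q) u) ∈ (O : Set RP2) := by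
    intro O O' hOO u hu hqO
    have hne : O ≠ O' := by rcases hOO with ⟨rfl, rfl⟩ | ⟨rfl, rfl⟩ <;> tauto
    have hO' : O' = O₁ ∨ O' = O₂ := by tauto
    have hq0 : eval q F = 0 :=
      (toRP_mem_realPart hF hp.infty_ne_zero).1 (ovals_subset_realPart O hqO)
    obtain ⟨Z, hZ, hZO⟩ := exists_finset_crossings hD hp {O'}
      (by
        intro A hA h
        rw [Finset.mem_singleton] at hA
        exact hne (ovals_eq_of_mem hqO (hA ▸ h)))
      (fun A hA => Or.inr (h1 A (by rwa [Finset.mem_singleton.1 hA])))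
      (fun A hA => Or.inr (h2 A (by rwa [Finset.mem_singleton.1 hA])))
    refine ⟨insert u Z, ?_, ?_⟩
    · rw [Finset.card_insert_of_notMem, hZ, Finset.card_singleton]
      · apply natDegree_le_of_coeff_eq_zero hdeg
        have := coeff_aeval_curve hF hp.natDegree_le
        rwa [hq, hq0] at this
      · intro huZ
        obtain ⟨A, hA, huA⟩ := hZO u huZ
        rw [Finset.mem_singleton] at hA
        exact hne (ovals_eq_of_mem hu (hA ▸ huA))
    · intro t ht
      rcases Finset.mem_insert.1 ht with rfl | ht
      · exact ⟨O, hu⟩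
      · obtain ⟨A, -, h⟩ := hZO t ht
        exact ⟨A, h⟩
  by_cases hq1 : toRP q ∈ (O₁ : Set RP2)
  · exact hinf O₁ O₂ (Or.inl ⟨rfl, rfl⟩) u₁ hu₁ hq1
  by_cases hq2 : toRP q ∈ (O₂ : Set RP2)
  · exact hinf O₂ O₁ (Or.inr ⟨rfl, rfl⟩) u₂ hu₂ hq2
  obtain ⟨Z, hZ, hZO⟩ := exists_finset_crossings hD hp {O₁, O₂}
    (by
      intro A hA
      rcases Finset.mem_insert.1 hA with rfl | hA
      · exact hq1
      · rwa [Finset.mem_singleton.1 hA])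
    (fun A hA => Or.inr (h1 A (by simpa using hA)))
    (fun A hA => Or.inr (h2 A (by simpa using hA)))
  rw [Finset.card_pair h12] at hZ
  refine ⟨Z, by omega, fun u hu => ?_⟩
  obtain ⟨A, -, h⟩ := hZO u hu
  exact ⟨A, h⟩

/-- Ovals account for all but at most one root on the whole line, counted with multiplicity. The
pseudoline count is therefore at most 1 and, being even, is 0, so the sign principle applies to the
segment. -/
theorem eval_mul_eval_pos_of_even (hF : F.IsHomogeneous 5) (hns : IsNonsingular F)
    {D : ovals F → Set RP2} (hD : DiscChoice D) {O₁ O₂ : ovals F} (h12 : O₁ ≠ O₂)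
    {v₁ v₂ : Fin 3 → ℝ} (hv₁ : v₁ ≠ 0) (hv₂ : v₂ ≠ 0) (h₁ : toRP v₁ ∈ interior (D O₁))
    (h₁' : ∀ O, O ≠ O₁ → toRP v₁ ∉ D O) (h₂ : toRP v₂ ∈ interior (D O₂))
    (h₂' : ∀ O, O ≠ O₂ → toRP v₂ ∉ D O) (heven : Even (pseudolineCount F v₁ v₂)) :
    0 < eval v₁ F * eval v₂ F := by
  classical
  have hne : toRP v₁ ≠ toRP v₂ := fun h => h₁' O₂ h12.symm (h ▸ interior_subset h₂)
  have hab := SpansLine.of_toRP_ne hv₁ hv₂ hne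
  have hab' : SpansLine v₁ (v₂ - v₁) := by
    intro s t h
    obtain ⟨e1, e2⟩ := hab (s - t) t (by rw [← h]; module)
    exact ⟨by linarith, e2⟩
  have hp := isProjCurve_linePoly hab'
  set p := linePoly v₁ (v₂ - v₁) with hpdef
  have hpt : ∀ u, curvePt p u = (1 - u) • v₁ + u • v₂ := fun u => by
    rw [hpdef, curvePt_linePoly]; module
  have hp0 : curvePt p 0 = v₁ := by rw [hpt]; simp
  have hp1 : curvePt p 1 = v₂ := by rw [hpt]; simp
  rw [← hp0] at h₁ h₁'
  rw [← hp1] at h₂ h₂'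
  obtain ⟨w₁, -, -, -, hw₁⟩ := (hD O₁).exists_crossing (γ := fun u => toRP (curvePt p u))
    hp.continuous.continuousOn h₁ (h₂' O₁ h12)
  obtain ⟨w₂, -, -, -, hw₂⟩ := (hD O₂).exists_crossing (γ := fun u => toRP (curvePt p u))
    hp.continuous.continuousOn h₂ (h₁' O₂ h12.symm)
  have hg : aeval p F ≠ 0 := aeval_curve_ne_zero hF (fun u _ => hp.ne_zero u) h12 hw₁ hw₂
  obtain ⟨Z, hZ, hZO⟩ := exists_finset_roots_line hF hD hp h12
    (by
      rintro O (rfl | rfl)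
      exacts [⟨0, h₁⟩, ⟨1, h₂⟩])
    (by
      rintro O (rfl | rfl)
      exacts [⟨1, h₂' _ h12⟩, ⟨0, h₁' _ h12.symm⟩]) hw₁ hw₂
  have hroot : ∀ u, u ∈ (aeval p F).roots ↔ toRP (curvePt p u) ∈ realPart F := fun u => by
    rw [Polynomial.mem_roots hg, Polynomial.IsRoot, eval_aeval_curve,
      toRP_mem_realPart hF (hp.ne_zero u)]
  let J : ℝ → Prop := fun t => t ∈ Set.Icc (0 : ℝ) 1 ∧
    ∃ P ∈ pseudoline F, Represents ((1 - t) • v₁ + t • v₂) P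
  have hJ : pseudolineCount F v₁ v₂ = ((aeval p F).roots.filter J).card := by
    unfold pseudolineCount
    rw [restrictToLine_eq]
  have hZJ : Z.val ≤ (aeval p F).roots.filter fun t => ¬ J t := by
    rw [Multiset.le_iff_subset Z.nodup]
    intro u hu
    obtain ⟨O, hO⟩ := hZO u hu
    have hr := ovals_subset_realPart O hO
    refine Multiset.mem_filter.2 ⟨(hroot u).2 hr, ?_⟩
    rintro ⟨-, P, hP, hPu⟩
    obtain ⟨-, rfl⟩ := represents_iff.1 hPu
    rw [← hpt] at hP
    exact (mem_pseudoline_iff hr).1 hP ⟨O, hO⟩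
  have hcard : pseudolineCount F v₁ v₂ ≤ 1 := by
    have e1 := congrArg Multiset.card (Multiset.filter_add_not J (aeval p F).roots)
    rw [Multiset.card_add] at e1
    have e2 := Multiset.card_le_card hZJ
    have e3 := (Polynomial.card_roots' (aeval p F)).trans hZ
    rw [Finset.card_val] at e2
    omega
  have hzero : (aeval p F).roots.filter J = 0 := by
    rw [← Multiset.card_eq_zero, ← hJ]
    rcases heven with ⟨k, hk⟩
    omega
  have := eval_mul_eval_pos hF hns hD (fun u _ => hp.ne_zero u) hg
    (by
      intro u hu h0
      have hr := (toRP_mem_realPart hF (hp.ne_zero u)).2 h0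
      by_contra hO
      have : u ∈ (aeval p F).roots.filter J := by
        refine Multiset.mem_filter.2 ⟨(hroot u).2 hr, ?_, _, (mem_pseudoline_iff hr).2 hO, ?_⟩
        · rwa [uIcc_of_le zero_le_one] at hu
        · rw [← hpt]
          exact represents_iff.2 ⟨hp.ne_zero u, rfl⟩
      rw [hzero] at this
      exact Multiset.notMem_zero _ this) h₁ h₁' h₂ h₂'
  rwa [hp0, hp1] at this

/-! ### The conic through five points -/

/-- A quadratic curve in `ℝ³`. -/
def quadPoly (α β q : Fin 3 → ℝ) : Fin 3 → Polynomial ℝ := fun i =>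
  Polynomial.C (α i) + Polynomial.C (β i) * Polynomial.X + Polynomial.C (q i) * Polynomial.X ^ 2

theorem curvePt_quadPoly (α β q : Fin 3 → ℝ) (u : ℝ) :
    curvePt (quadPoly α β q) u = α + u • β + u ^ 2 • q := by
  ext i
  simp [curvePt, quadPoly, mul_comm u, mul_comm (u ^ 2)]

/-- The parametrization of the conic through the points `v₀`, `v₁`, `v₂` (with parameters `m₀`,
`m₁`, `m₂`) and `v₀ + v₁ + v₂` (at infinity). -/
def conicPoly (v₀ v₁ v₂ : Fin 3 → ℝ) (m₀ m₁ m₂ : ℝ) : Fin 3 → Polynomial ℝ :=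
  quadPoly ((m₁ * m₂) • v₀ + (m₀ * m₂) • v₁ + (m₀ * m₁) • v₂)
    (-((m₁ + m₂) • v₀ + (m₀ + m₂) • v₁ + (m₀ + m₁) • v₂)) (v₀ + v₁ + v₂)

theorem curvePt_conicPoly (v₀ v₁ v₂ : Fin 3 → ℝ) (m₀ m₁ m₂ u : ℝ) :
    curvePt (conicPoly v₀ v₁ v₂ m₀ m₁ m₂) u = ((u - m₁) * (u - m₂)) • v₀ +
      ((u - m₀) * (u - m₂)) • v₁ + ((u - m₀) * (u - m₁)) • v₂ := by
  rw [conicPoly, curvePt_quadPoly]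
  module

theorem isProjCurve_conicPoly {v₀ v₁ v₂ : Fin 3 → ℝ} {m₀ m₁ m₂ : ℝ}
    (hv : ∀ a b c : ℝ, a • v₀ + b • v₁ + c • v₂ = 0 → a = 0 ∧ b = 0 ∧ c = 0)
    (h01 : m₀ ≠ m₁) (h02 : m₀ ≠ m₂) (h12 : m₁ ≠ m₂) :
    IsProjCurve (conicPoly v₀ v₁ v₂ m₀ m₁ m₂) 2 (v₀ + v₁ + v₂) where
  natDegree_le i := by
    unfold conicPoly quadPoly
    compute_degree
  coeff_eq i := by
    simp only [conicPoly, quadPoly, Polynomial.coeff_add, Polynomial.coeff_C_mul,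
      Polynomial.coeff_X_pow, Polynomial.coeff_C, Polynomial.coeff_X]
    norm_num
  ne_zero u hu := by
    rw [curvePt_conicPoly] at hu
    obtain ⟨e0, e1, e2⟩ := hv _ _ _ hu
    simp only [mul_eq_zero, sub_eq_zero] at e0 e1 e2
    grind
  infty_ne_zero h := one_ne_zero (hv 1 1 1 (by simpa using h)).1

/-- Of the three products (a - b)(a - c), (b - a)(b - c), (c - a)(c - b), any two multiply to minus
a square times the third. If all pairs had equal signs, all three would be negative, yet their sum
is half a sum of squares. -/
theorem not_all_mul_pos {a b c : ℝ} (hab : a - b ≠ 0) (hac : a - c ≠ 0) (hbc : b - c ≠ 0)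
    (h₁ : 0 < (a - b) * (a - c) * ((b - a) * (b - c)))
    (h₂ : 0 < (a - b) * (a - c) * ((c - a) * (c - b)))
    (h₃ : 0 < (b - a) * (b - c) * ((c - a) * (c - b))) : False := by
  have key : ∀ {d s t : ℝ}, d ≠ 0 → 0 < s → s = -(d ^ 2 * t) → t < 0 := by
    intro d s t hd hs h
    have : 0 < d ^ 2 := by positivity
    nlinarith
  have e₁ : (c - a) * (c - b) < 0 := key hab h₁ (by ring)
  have e₂ : (b - a) * (b - c) < 0 := key hac h₂ (by ring)
  have e₃ : (a - b) * (a - c) < 0 := key hbc h₃ (by ring)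
  nlinarith [sq_nonneg (a - b), sq_nonneg (a - c), sq_nonneg (b - c)]

theorem mul_pos_of_pow_five {s t A B : ℝ} (hA : 0 < A) (hB : 0 < B)
    (h : 0 < s ^ 5 * A * (t ^ 5 * B)) : 0 < s * t := by
  have h1 : 0 < (s * t) ^ 5 * (A * B) := by
    calc (0 : ℝ) < _ := h
      _ = _ := by ring
  exact (Odd.pow_pos_iff (by decide)).1 ((mul_pos_iff_of_pos_right (mul_pos hA hB)).1 h1)

/-- If the vectors `v₀`, `v₁`, `v₂` represent points in three ovals of a quintic `F = 0` and `F` is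
positive at them, then `v₀ + v₁ + v₂` does not represent a point in a fourth oval, provided that
these four points and a point in a fifth oval lie on a nondegenerate conic. -/
theorem false_of_conic (hF : F.IsHomogeneous 5) (hns : IsNonsingular F)
    {D : ovals F → Set RP2} (hD : DiscChoice D) {x : ovals F → RP2}
    (hx : ∀ O, x O ∈ interior (D O)) (hx' : ∀ O O', O ≠ O' → x O ∉ D O')
    {O₀ O₁ O₂ O₃ O₄ : ovals F} (hO : [O₀, O₁, O₂, O₃, O₄].Nodup) {v₀ v₁ v₂ : Fin 3 → ℝ}
    (hv : ∀ a b c : ℝ, a • v₀ + b • v₁ + c • v₂ = 0 → a = 0 ∧ b = 0 ∧ c = 0)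
    (hx₀ : toRP v₀ = x O₀) (hx₁ : toRP v₁ = x O₁) (hx₂ : toRP v₂ = x O₂)
    (hx₃ : toRP (v₀ + v₁ + v₂) = x O₃) {r₀ r₁ r₂ : ℝ} (hr₀ : r₀ ≠ 0) (hr₁ : r₁ ≠ 0) (hr₂ : r₂ ≠ 0)
    (h01 : r₀ ≠ r₁) (h02 : r₀ ≠ r₂) (h12 : r₁ ≠ r₂)
    (hx₄ : toRP (r₀ • v₀ + r₁ • v₁ + r₂ • v₂) = x O₄)
    (hF₀ : 0 < eval v₀ F) (hF₁ : 0 < eval v₁ F) (hF₂ : 0 < eval v₂ F) : False := by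
  classical
  -- With parameters mᵢ = rᵢ⁻¹ the conic at u = 0 is m₀m₁m₂ times the fifth vector.
  obtain ⟨m₀, rfl⟩ : ∃ m, r₀ = m⁻¹ := ⟨r₀⁻¹, (inv_inv _).symm⟩
  obtain ⟨m₁, rfl⟩ : ∃ m, r₁ = m⁻¹ := ⟨r₁⁻¹, (inv_inv _).symm⟩
  obtain ⟨m₂, rfl⟩ : ∃ m, r₂ = m⁻¹ := ⟨r₂⁻¹, (inv_inv _).symm⟩
  rw [Ne, inv_eq_zero] at hr₀ hr₁ hr₂
  rw [Ne, inv_inj] at h01 h02 h12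
  have hp := isProjCurve_conicPoly hv h01 h02 h12
  set p := conicPoly v₀ v₁ v₂ m₀ m₁ m₂ with hpdef
  have c0 : curvePt p m₀ = ((m₀ - m₁) * (m₀ - m₂)) • v₀ := by
    rw [hpdef, curvePt_conicPoly]; module
  have c1 : curvePt p m₁ = ((m₁ - m₀) * (m₁ - m₂)) • v₁ := by
    rw [hpdef, curvePt_conicPoly]; module
  have c2 : curvePt p m₂ = ((m₂ - m₀) * (m₂ - m₁)) • v₂ := by
    rw [hpdef, curvePt_conicPoly]; module
  have p0 : toRP (curvePt p m₀) = x O₀ := by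
    rw [c0, toRP_smul (mul_ne_zero (sub_ne_zero.2 h01) (sub_ne_zero.2 h02)), hx₀]
  have p1 : toRP (curvePt p m₁) = x O₁ := by
    rw [c1, toRP_smul (mul_ne_zero (sub_ne_zero.2 (Ne.symm h01)) (sub_ne_zero.2 h12)), hx₁]
  have p2 : toRP (curvePt p m₂) = x O₂ := by
    rw [c2, toRP_smul (mul_ne_zero (sub_ne_zero.2 (Ne.symm h02)) (sub_ne_zero.2 (Ne.symm h12))),
      hx₂]
  have p4 : toRP (curvePt p 0) = x O₄ := by
    have : curvePt p 0 = (m₀ * m₁ * m₂) • (m₀⁻¹ • v₀ + m₁⁻¹ • v₁ + m₂⁻¹ • v₂) := by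
      rw [hpdef, curvePt_conicPoly, smul_add, smul_add, smul_smul, smul_smul, smul_smul]
      congr 1
      · congr 1
        · congr 1; field_simp; ring
        · congr 1; field_simp; ring
      · congr 1; field_simp; ring
    rw [this, toRP_smul (mul_ne_zero (mul_ne_zero hr₀ hr₁) hr₂), hx₄]
  have hxO : ∀ O O' : ovals F, x O ∉ (O' : Set RP2) := by
    intro O O' h
    by_cases hOO : O = O'
    · subst hOO
      exact (hD O).not_mem_boundary_of_mem_interior (hx O) h
    · exact hx' O O' hOO ((hD O').boundary_subset h)
  let S : Finset (ovals F) := {O₀, O₁, O₂, O₃, O₄}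
  have hS : S.card = 5 := by
    have : S = [O₀, O₁, O₂, O₃, O₄].toFinset := by simp [S]
    rw [this, List.toFinset_card_of_nodup hO]
    rfl
  have hne03 : O₀ ≠ O₃ := by
    rintro rfl
    simp at hO
  have hne01 : O₀ ≠ O₁ := by
    rintro rfl
    simp at hO
  have hin : ∀ O ∈ S, x O = toRP (v₀ + v₁ + v₂) ∨ ∃ u, x O = toRP (curvePt p u) := by
    intro O hOS
    simp only [S, Finset.mem_insert, Finset.mem_singleton] at hOS
    rcases hOS with rfl | rfl | rfl | rfl | rfl
    exacts [Or.inr ⟨_, p0.symm⟩, Or.inr ⟨_, p1.symm⟩, Or.inr ⟨_, p2.symm⟩, Or.inl hx₃.symm,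
      Or.inr ⟨_, p4.symm⟩]
  have cross : ∀ S' ⊆ S, ∃ Z : Finset ℝ, Z.card = 2 * S'.card ∧
      ∀ u ∈ Z, ∃ O ∈ S', toRP (curvePt p u) ∈ (O : Set RP2) := by
    intro S' hS'
    refine exists_finset_crossings hD hp S' (fun O _ => hx₃ ▸ hxO O₃ O) ?_ ?_
    · intro O hO'
      rcases hin O (hS' hO') with h | ⟨u, h⟩
      · exact Or.inl (h ▸ hx O)
      · exact Or.inr ⟨u, h ▸ hx O⟩
    · intro O _
      by_cases h : O = O₃
      · refine Or.inr ⟨m₀, ?_⟩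
        rw [p0, h]
        exact hx' _ _ hne03
      · refine Or.inl ?_
        rw [hx₃]
        exact hx' _ _ (Ne.symm h)
  have hmeet : ∀ O ∈ S, ∃ u, toRP (curvePt p u) ∈ (O : Set RP2) := by
    intro O hO
    obtain ⟨Z, hZ, hZO⟩ := cross {O} (Finset.singleton_subset_iff.2 hO)
    rw [Finset.card_singleton] at hZ
    obtain ⟨u, hu⟩ := Finset.card_pos.1 (by omega : 0 < Z.card)
    obtain ⟨O', hO', h⟩ := hZO u hu
    exact ⟨u, Finset.mem_singleton.1 hO' ▸ h⟩
  have hg : aeval p F ≠ 0 := by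
    obtain ⟨a, ha⟩ := hmeet O₀ (by simp [S])
    obtain ⟨b, hb⟩ := hmeet O₁ (by simp [S])
    exact aeval_curve_ne_zero hF (fun u _ => hp.ne_zero u) hne01 ha hb
  obtain ⟨Z, hZ, hZO⟩ := cross S subset_rfl
  -- Ten distinct roots on the five ovals exhaust the degree 5 · 2, so none lies on the pseudoline.
  have hroots : Z.val = (aeval p F).roots := by
    refine Multiset.eq_of_le_of_card_le ?_ ?_
    · rw [Multiset.le_iff_subset Z.nodup]
      intro u hu
      obtain ⟨O, -, h⟩ := hZO u hu
      rw [Polynomial.mem_roots hg, Polynomial.IsRoot, eval_aeval_curve]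
      exact (toRP_mem_realPart hF (hp.ne_zero u)).1 (ovals_subset_realPart O h)
    · rw [Finset.card_val, hZ, hS]
      exact (Polynomial.card_roots' _).trans (natDegree_aeval_curve_le hF hp.natDegree_le)
  have hz : ∀ u, eval (curvePt p u) F = 0 →
      ∃ O : ovals F, toRP (curvePt p u) ∈ (O : Set RP2) := by
    intro u hu
    have : u ∈ Z.val := by
      rw [hroots, Polynomial.mem_roots hg, Polynomial.IsRoot, eval_aeval_curve, hu]
    obtain ⟨O, -, h⟩ := hZO u this
    exact ⟨O, h⟩
  have hpos : ∀ {a b : ℝ} {Oa Ob : ovals F}, toRP (curvePt p a) = x Oa →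
      toRP (curvePt p b) = x Ob → 0 < eval (curvePt p a) F * eval (curvePt p b) F := by
    intro a b Oa Ob ha hb
    exact eval_mul_eval_pos hF hns hD (fun u _ => hp.ne_zero u) hg (fun u _ => hz u)
      (ha ▸ hx Oa) (fun O h => ha ▸ hx' Oa O h.symm) (hb ▸ hx Ob)
      (fun O h => hb ▸ hx' Ob O h.symm)
  have q01 := hpos p0 p1
  have q02 := hpos p0 p2
  have q12 := hpos p1 p2
  rw [c0, c1, eval_smul_of_isHomogeneous hF, eval_smul_of_isHomogeneous hF] at q01
  rw [c0, c2, eval_smul_of_isHomogeneous hF, eval_smul_of_isHomogeneous hF] at q02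
  rw [c1, c2, eval_smul_of_isHomogeneous hF, eval_smul_of_isHomogeneous hF] at q12
  have d01 := mul_pos_of_pow_five hF₀ hF₁ q01
  have d02 := mul_pos_of_pow_five hF₀ hF₂ q02
  have d12 := mul_pos_of_pow_five hF₁ hF₂ q12
  exact not_all_mul_pos (sub_ne_zero.2 h01) (sub_ne_zero.2 h02) (sub_ne_zero.2 h12) d01 d02 d12

end Ovals


/-! ### Segments and triangles -/

theorem mem_projSegment_iff {a b : Fin 3 → ℝ} {P : RP2} : P ∈ projSegment a b ↔
    ∃ s t : ℝ, 0 ≤ s ∧ 0 ≤ t ∧ s • a + t • b ≠ 0 ∧ toRP (s • a + t • b) = P := by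
  constructor
  · rintro ⟨_, ⟨s, t, hs, ht, -, rfl⟩, h⟩
    exact ⟨s, t, hs, ht, represents_iff.1 h⟩
  · rintro ⟨s, t, hs, ht, h0, h⟩
    have hst : s + t ≠ 0 := by
      intro hst
      apply h0
      rw [show s = 0 by linarith, show t = 0 by linarith, zero_smul, zero_smul, add_zero]
    refine ⟨(s + t)⁻¹ • (s • a + t • b), ⟨s / (s + t), t / (s + t), by positivity, by positivity,
      by field_simp, by rw [smul_add, smul_smul, smul_smul, inv_mul_eq_div, inv_mul_eq_div]⟩,
      represents_iff.2 ⟨smul_ne_zero (inv_ne_zero hst) h0, ?_⟩⟩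
    rw [toRP_smul (inv_ne_zero hst), h]

theorem projSegment_smul_smul_subset {a b : Fin 3 → ℝ} {r r' : ℝ} (h : 0 < r * r') :
    projSegment (r • a) (r' • b) ⊆ projSegment a b := by
  intro P hP
  rw [mem_projSegment_iff] at hP ⊢
  obtain ⟨s, t, hs, ht, h0, rfl⟩ := hP
  have e : s • r • a + t • r' • b = (s * r) • a + (t * r') • b := by module
  rcases mul_pos_iff.1 h with ⟨h1, h2⟩ | ⟨h1, h2⟩
  · exact ⟨s * r, t * r', by positivity, by positivity, e ▸ h0, by rw [e]⟩
  · have e' : s • r • a + t • r' • b = (-1 : ℝ) • ((s * -r) • a + (t * -r') • b) := by module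
    refine ⟨s * -r, t * -r', mul_nonneg hs (by linarith), mul_nonneg ht (by linarith), ?_, ?_⟩
    · intro h3
      rw [e', h3, smul_zero] at h0
      exact h0 rfl
    · rw [e', toRP_smul (by norm_num)]

theorem projSegment_smul_smul {a b : Fin 3 → ℝ} {r r' : ℝ} (h : 0 < r * r') :
    projSegment (r • a) (r' • b) = projSegment a b := by
  refine (projSegment_smul_smul_subset h).antisymm ?_
  have h1 := left_ne_zero_of_mul h.ne'
  have h2 := right_ne_zero_of_mul h.ne'
  have := projSegment_smul_smul_subset (a := r • a) (b := r' • b) (r := r⁻¹) (r' := r'⁻¹)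
    (by rw [← mul_inv]; exact inv_pos.2 h)
  rwa [inv_smul_smul₀ h1, inv_smul_smul₀ h2] at this

/-- The union of the sides of the triangle spanned by three vectors. -/
def triangleSides (v₀ v₁ v₂ : Fin 3 → ℝ) : Set RP2 :=
  projSegment v₀ v₁ ∪ projSegment v₀ v₂ ∪ projSegment v₁ v₂

/-- Three vectors without a nontrivial linear relation. -/
def Independent₃ (v₀ v₁ v₂ : Fin 3 → ℝ) : Prop :=
  ∀ a b c : ℝ, a • v₀ + b • v₁ + c • v₂ = 0 → a = 0 ∧ b = 0 ∧ c = 0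

theorem Independent₃.exists_coords {v₀ v₁ v₂ : Fin 3 → ℝ} (hv : Independent₃ v₀ v₁ v₂)
    (w : Fin 3 → ℝ) : ∃ a b c : ℝ, w = a • v₀ + b • v₁ + c • v₂ := by
  have hli : LinearIndependent ℝ ![v₀, v₁, v₂] := by
    rw [Fintype.linearIndependent_iff]
    intro g hg
    rw [Fin.sum_univ_three] at hg
    obtain ⟨h0, h1, h2⟩ := hv _ _ _ hg
    intro i
    fin_cases i <;> assumption
  let B := basisOfLinearIndependentOfCardEqFinrank hli (by simp)
  refine ⟨B.repr w 0, B.repr w 1, B.repr w 2, ?_⟩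
  conv_lhs => rw [← B.sum_repr w]
  rw [Fin.sum_univ_three]
  simp [B]

/-- The coordinates of a point on the sides of a triangle do not have mixed signs. -/
theorem Independent₃.same_sign_of_mem_triangleSides {v₀ v₁ v₂ : Fin 3 → ℝ}
    (hv : Independent₃ v₀ v₁ v₂) {a b c : ℝ}
    (h : toRP (a • v₀ + b • v₁ + c • v₂) ∈ triangleSides v₀ v₁ v₂)
    (h0 : a • v₀ + b • v₁ + c • v₂ ≠ 0) :
    (0 ≤ a ∧ 0 ≤ b ∧ 0 ≤ c) ∨ (a ≤ 0 ∧ b ≤ 0 ∧ c ≤ 0) := by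
  obtain ⟨s, t, z, hs, ht, hz, h1, h2⟩ : ∃ s t z : ℝ, 0 ≤ s ∧ 0 ≤ t ∧ 0 ≤ z ∧
      s • v₀ + t • v₁ + z • v₂ ≠ 0 ∧
      toRP (s • v₀ + t • v₁ + z • v₂) = toRP (a • v₀ + b • v₁ + c • v₂) := by
    rcases h with (h | h) | h <;> obtain ⟨s, t, hs, ht, h1, h2⟩ := mem_projSegment_iff.1 h
    · exact ⟨s, t, 0, hs, ht, le_rfl, by simpa using h1, by simpa using h2⟩
    · exact ⟨s, 0, t, hs, le_rfl, ht, by simpa using h1, by simpa using h2⟩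
    · exact ⟨0, s, t, le_rfl, hs, ht, by simpa using h1, by simpa using h2⟩
  obtain ⟨r, hr, h3⟩ := exists_smul_of_toRP_eq h0 h1 h2.symm
  obtain ⟨e0, e1, e2⟩ := hv (a - r * s) (b - r * t) (c - r * z) (by
    rw [show (a - r * s) • v₀ + (b - r * t) • v₁ + (c - r * z) • v₂ =
      (a • v₀ + b • v₁ + c • v₂) - r • (s • v₀ + t • v₁ + z • v₂) by module, h3, sub_self])
  rw [sub_eq_zero] at e0 e1 e2
  rw [e0, e1, e2]
  rcases lt_or_gt_of_ne hr with hr | hr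
  · exact Or.inr ⟨mul_nonpos_of_nonpos_of_nonneg hr.le hs, mul_nonpos_of_nonpos_of_nonneg hr.le ht,
      mul_nonpos_of_nonpos_of_nonneg hr.le hz⟩
  · exact Or.inl ⟨by positivity, by positivity, by positivity⟩

/-- Lowering a negative coordinate keeps it negative and leaves a positive one untouched. Since d +
e + f = 1, the coordinate sum reaches 0 at time a + b + c. -/
theorem exists_decreasing_path {a b c : ℝ} (hpos : 0 < a ∨ 0 < b ∨ 0 < c)
    (hneg : a < 0 ∨ b < 0 ∨ c < 0) : ∃ d e f : ℝ, d + e + f = 1 ∧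
      ∀ t ≥ 0, (0 < a - t * d ∨ 0 < b - t * e ∨ 0 < c - t * f) ∧
        (a - t * d < 0 ∨ b - t * e < 0 ∨ c - t * f < 0) := by
  rcases hneg with h | h | h
  · refine ⟨1, 0, 0, by norm_num, fun t ht => ⟨?_, Or.inl (by linarith)⟩⟩
    rcases hpos with h' | h' | h'
    · linarith
    · exact Or.inr (Or.inl (by linarith))
    · exact Or.inr (Or.inr (by linarith))
  · refine ⟨0, 1, 0, by norm_num, fun t ht => ⟨?_, Or.inr (Or.inl (by linarith))⟩⟩
    rcases hpos with h' | h' | h'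
    · exact Or.inl (by linarith)
    · linarith
    · exact Or.inr (Or.inr (by linarith))
  · refine ⟨0, 0, 1, by norm_num, fun t ht => ⟨?_, Or.inr (Or.inr (by linarith))⟩⟩
    rcases hpos with h' | h' | h'
    · exact Or.inl (by linarith)
    · exact Or.inr (Or.inl (by linarith))
    · linarith

/-- The interior of a disc bounded by the sides of a triangle consists of the positive
combinations of the vertices. -/
theorem Independent₃.exists_pos_of_mem_interior {v₀ v₁ v₂ : Fin 3 → ℝ}
    (hv : Independent₃ v₀ v₁ v₂) {T : Set RP2} (hT : IsClosedDisc T (triangleSides v₀ v₁ v₂))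
    {P : RP2} (hP : P ∈ interior T) :
    ∃ a b c : ℝ, 0 < a ∧ 0 < b ∧ 0 < c ∧ toRP (a • v₀ + b • v₁ + c • v₂) = P := by
  obtain ⟨a, b, c, h0, hsum, rfl⟩ : ∃ a b c : ℝ, a • v₀ + b • v₁ + c • v₂ ≠ 0 ∧ 0 ≤ a + b + c ∧
      toRP (a • v₀ + b • v₁ + c • v₂) = P := by
    obtain ⟨a, b, c, h⟩ := hv.exists_coords P.rep
    have hne : a • v₀ + b • v₁ + c • v₂ ≠ 0 := h ▸ P.rep_nonzero
    rcases le_total 0 (a + b + c) with h' | h'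
    · exact ⟨a, b, c, hne, h', by rw [← h, toRP_rep]⟩
    · have e : (-a) • v₀ + (-b) • v₁ + (-c) • v₂ = (-1 : ℝ) • (a • v₀ + b • v₁ + c • v₂) := by
        module
      refine ⟨-a, -b, -c, ?_, by linarith, ?_⟩
      · rw [e]; exact smul_ne_zero (by norm_num) hne
      · rw [e, toRP_smul (by norm_num), ← h, toRP_rep]
  have hside := hT.not_mem_boundary_of_mem_interior hP
  have hpos : 0 < a ∨ 0 < b ∨ 0 < c := by
    by_contra! h
    apply h0
    rw [show a = 0 by linarith, show b = 0 by linarith, show c = 0 by linarith]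
    simp
  by_cases hneg : a < 0 ∨ b < 0 ∨ c < 0
  · exfalso
    -- A point with coordinates of mixed signs moves, without touching the sides, to the line where
    -- the coordinates sum to 0. That line misses the sides too, yet a line entering the disc must
    -- meet its boundary.
    obtain ⟨d, e, f, hdef, hpath⟩ := exists_decreasing_path hpos hneg
    have mixed : ∀ {a b c : ℝ}, (0 < a ∨ 0 < b ∨ 0 < c) → (a < 0 ∨ b < 0 ∨ c < 0) →
        a • v₀ + b • v₁ + c • v₂ ≠ 0 ∧
          toRP (a • v₀ + b • v₁ + c • v₂) ∉ triangleSides v₀ v₁ v₂ := by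
      intro a b c h1 h2
      have h3 : a • v₀ + b • v₁ + c • v₂ ≠ 0 := by
        intro h
        obtain ⟨e0, e1, e2⟩ := hv _ _ _ h
        simp [e0, e1, e2] at h1
      refine ⟨h3, fun h => ?_⟩
      rcases hv.same_sign_of_mem_triangleSides h h3 with ⟨h4, h5, h6⟩ | ⟨h4, h5, h6⟩
      · rcases h2 with h2 | h2 | h2 <;> linarith
      · rcases h1 with h1 | h1 | h1 <;> linarith
    have hline : SpansLine (v₀ - v₁) (v₁ - v₂) := by
      intro s t h
      obtain ⟨e0, -, e2⟩ := hv s (t - s) (-t) (by rw [← h]; module)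
      exact ⟨e0, by linarith⟩
    have hline' : ∀ Q ∈ projLine (v₀ - v₁) (v₁ - v₂), Q ∉ triangleSides v₀ v₁ v₂ := by
      rintro _ ⟨s, t, hst, rfl⟩
      have e : s • (v₀ - v₁) + t • (v₁ - v₂) = s • v₀ + (t - s) • v₁ + (-t) • v₂ := by module
      rw [e] at hst ⊢
      refine (mixed ?_ ?_).2
      · by_contra! h
        apply hst
        rw [show s = 0 by linarith, show t = 0 by linarith]
        simp
      · by_contra! h
        apply hst
        rw [show s = 0 by linarith, show t = 0 by linarith]
        simp
    let γ : ℝ → Fin 3 → ℝ := fun t => (a - t * d) • v₀ + (b - t * e) • v₁ + (c - t * f) • v₂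
    have hγ : Continuous γ := by fun_prop
    have hpre : IsPreconnected ((fun t => toRP (γ t)) '' Icc 0 (a + b + c)) :=
      isPreconnected_Icc.image _ (continuousOn_toRP.comp hγ.continuousOn fun t ht =>
        (mixed (hpath t ht.1).1 (hpath t ht.1).2).1)
    have hγ0 : toRP (γ 0) ∈ interior T := by simpa [γ] using hP
    have hend : toRP (γ (a + b + c)) ∈ interior T := by
      rcases hT.subset_or_subset hpre (by
        rintro _ ⟨t, ht, rfl⟩
        exact (mixed (hpath t ht.1).1 (hpath t ht.1).2).2) with h | h
      · exact h ⟨_, ⟨hsum, le_rfl⟩, rfl⟩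
      · exact absurd (interior_subset hγ0) (h ⟨0, ⟨le_rfl, hsum⟩, rfl⟩)
    have hendL : toRP (γ (a + b + c)) ∈ projLine (v₀ - v₁) (v₁ - v₂) := by
      have e' : γ (a + b + c) = (a - (a + b + c) * d) • (v₀ - v₁) +
          ((a - (a + b + c) * d) + (b - (a + b + c) * e)) • (v₁ - v₂) := by
        have hf : f = 1 - d - e := by linarith
        simp only [γ, hf]
        module
      refine ⟨_, _, ?_, congrArg toRP e'.symm⟩
      rw [← e']
      exact (mixed (hpath _ hsum).1 (hpath _ hsum).2).1
    obtain ⟨Q, hQL, hQ⟩ := hT.exists_mem_line hline hendL hend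
    exact hline' Q hQL hQ
  · push Not at hneg
    have hside' : ∀ S ⊆ triangleSides v₀ v₁ v₂, toRP (a • v₀ + b • v₁ + c • v₂) ∉ S :=
      fun S hS h => hside (hS h)
    refine ⟨a, b, c, hneg.1.lt_of_ne ?_, hneg.2.1.lt_of_ne ?_, hneg.2.2.lt_of_ne ?_, rfl⟩
    · rintro rfl
      rw [zero_smul, zero_add] at hside h0
      exact hside (Or.inr (mem_projSegment_iff.2 ⟨b, c, hneg.2.1, hneg.2.2, h0, rfl⟩))
    · rintro rfl
      rw [zero_smul, add_zero] at hside h0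
      exact hside (Or.inl (Or.inr (mem_projSegment_iff.2 ⟨a, c, hneg.1, hneg.2.2, h0, rfl⟩)))
    · rintro rfl
      rw [zero_smul, add_zero] at hside h0
      exact hside (Or.inl (Or.inl (mem_projSegment_iff.2 ⟨a, b, hneg.1, hneg.2.1, h0, rfl⟩)))

/-! ### Positive representatives and convex position. -/

section Ovals

variable {F : MvPolynomial (Fin 3) ℝ}

theorem not_collinear (hF : F.IsHomogeneous 5) {D : ovals F → Set RP2} (hD : DiscChoice D)
    {x : ovals F → RP2} (hx : ∀ O, x O ∈ interior (D O)) (hx' : ∀ O O', O ≠ O' → x O ∉ D O')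
    {O₁ O₂ O₃ : ovals F} (h12 : O₁ ≠ O₂) (h13 : O₁ ≠ O₃) (h23 : O₂ ≠ O₃) {a b : Fin 3 → ℝ}
    (ha0 : a ≠ 0) (hb0 : b ≠ 0) (ha : toRP a = x O₁) (hb : toRP b = x O₂) {s t : ℝ}
    (h0 : s • a + t • b ≠ 0) (h : toRP (s • a + t • b) = x O₃) : False := by
  have hab : SpansLine a b := by
    refine SpansLine.of_toRP_ne ha0 hb0 ?_
    rw [ha, hb]
    exact fun h => hx' O₁ O₂ h12 (h ▸ interior_subset (hx O₂))
  exact not_three_on_line hF hD hab h12 h13 h23 ⟨1, 0, by simpa using ha0, by simpa using ha⟩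
    ⟨0, 1, by simpa using hb0, by simpa using hb⟩ ⟨s, t, h0, h⟩ (hx O₁) (hx O₂) (hx O₃)

theorem independent₃_of_ovals (hF : F.IsHomogeneous 5) {D : ovals F → Set RP2} (hD : DiscChoice D)
    {x : ovals F → RP2} (hx : ∀ O, x O ∈ interior (D O)) (hx' : ∀ O O', O ≠ O' → x O ∉ D O')
    {O₁ O₂ O₃ : ovals F} (h12 : O₁ ≠ O₂) (h13 : O₁ ≠ O₃) (h23 : O₂ ≠ O₃) {a b c : Fin 3 → ℝ}
    (ha0 : a ≠ 0) (hb0 : b ≠ 0) (hc0 : c ≠ 0) (ha : toRP a = x O₁) (hb : toRP b = x O₂)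
    (hc : toRP c = x O₃) : Independent₃ a b c := by
  have hab : SpansLine a b := by
    refine SpansLine.of_toRP_ne ha0 hb0 ?_
    rw [ha, hb]
    exact fun h => hx' O₁ O₂ h12 (h ▸ interior_subset (hx O₂))
  intro r s t h
  by_cases ht : t = 0
  · subst ht
    rw [zero_smul, add_zero] at h
    exact ⟨(hab _ _ h).1, (hab _ _ h).2, rfl⟩
  · exfalso
    have hc' : c = (-r / t) • a + (-s / t) • b := by
      have h1 : t • c = t • ((-r / t) • a + (-s / t) • b) := by
        rw [smul_add, smul_smul, smul_smul, mul_div_cancel₀ _ ht, mul_div_cancel₀ _ ht,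
          eq_neg_of_add_eq_zero_right h]
        module
      exact smul_right_injective _ ht h1
    exact not_collinear hF hD hx hx' h12 h13 h23 ha0 hb0 ha hb (hc' ▸ hc0) (hc' ▸ hc)

/-- The segment `[x₁, x₂]_C` is the segment between positive representatives of its endpoints. -/
theorem IsCurveSegment.exists_pos (hF : F.IsHomogeneous 5) (hns : IsNonsingular F)
    {D : ovals F → Set RP2} (hD : DiscChoice D) {x : ovals F → RP2}
    (hx : ∀ O, x O ∈ interior (D O)) (hx' : ∀ O O', O ≠ O' → x O ∉ D O') {O₁ O₂ : ovals F}
    (h12 : O₁ ≠ O₂) {S : Set RP2} (hS : IsCurveSegment F (x O₁) (x O₂) S) :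
    eval (x O₁).rep F ≠ 0 ∧ eval (x O₂).rep F ≠ 0 ∧ ∀ v₁ v₂ : Fin 3 → ℝ, v₁ ≠ 0 → v₂ ≠ 0 →
      toRP v₁ = x O₁ → toRP v₂ = x O₂ → 0 < eval v₁ F → 0 < eval v₂ F →
        S = projSegment v₁ v₂ := by
  obtain ⟨-, w₁, w₂, hw₁, hw₂, rfl, heven⟩ := hS
  obtain ⟨hw₁0, hw₁⟩ := represents_iff.1 hw₁
  obtain ⟨hw₂0, hw₂⟩ := represents_iff.1 hw₂
  have hpos := eval_mul_eval_pos_of_even hF hns hD h12 hw₁0 hw₂0 (hw₁ ▸ hx O₁)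
    (fun O h => hw₁ ▸ hx' O₁ O h.symm) (hw₂ ▸ hx O₂) (fun O h => hw₂ ▸ hx' O₂ O h.symm) heven
  have hrep : ∀ {w : Fin 3 → ℝ} {O : ovals F}, w ≠ 0 → toRP w = x O → eval w F ≠ 0 →
      eval (x O).rep F ≠ 0 := by
    intro w O hw hwO h h'
    apply h
    rw [← toRP_mem_realPart hF hw, hwO]
    exact h'
  refine ⟨hrep hw₁0 hw₁ (left_ne_zero_of_mul hpos.ne'),
    hrep hw₂0 hw₂ (right_ne_zero_of_mul hpos.ne'), ?_⟩
  intro v₁ v₂ hv₁0 hv₂0 hv₁ hv₂ h₁ h₂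
  obtain ⟨r, hr, rfl⟩ := exists_smul_of_toRP_eq hw₁0 hv₁0 (hw₁.trans hv₁.symm)
  obtain ⟨r', hr', rfl⟩ := exists_smul_of_toRP_eq hw₂0 hv₂0 (hw₂.trans hv₂.symm)
  rw [eval_smul_of_isHomogeneous hF, eval_smul_of_isHomogeneous hF] at hpos
  exact projSegment_smul_smul (mul_pos_of_pow_five h₁ h₂ hpos)

/-- In odd degree, replacing a vector by its negative changes the sign of F. -/
theorem exists_pos_representative {n : ℕ} (hF : F.IsHomogeneous n) (hn : Odd n) {P : RP2}
    (h : eval P.rep F ≠ 0) : ∃ v : Fin 3 → ℝ, v ≠ 0 ∧ toRP v = P ∧ 0 < eval v F := by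
  rcases lt_or_gt_of_ne h with h | h
  · refine ⟨(-1 : ℝ) • P.rep, smul_ne_zero (by norm_num) P.rep_nonzero, ?_, ?_⟩
    · rw [toRP_smul (by norm_num), toRP_rep]
    · rw [eval_smul_of_isHomogeneous hF, hn.neg_one_pow]
      linarith
  · exact ⟨P.rep, P.rep_nonzero, toRP_rep P, h⟩

theorem exists_oval_notMem {n : ℕ} (h : (n : ℕ∞) < (ovals F).encard) (S : Finset (ovals F))
    (hS : S.card ≤ n) : ∃ O, O ∉ S := by
  classical
  by_contra! hcon
  have h1 : ovals F ⊆ (S.image Subtype.val : Finset (Set RP2)) := fun O hO =>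
    Finset.mem_coe.2 (Finset.mem_image.2 ⟨⟨O, hO⟩, hcon _, rfl⟩)
  have h2 := Set.encard_le_encard h1
  rw [Set.encard_coe_eq_coe_finsetCard] at h2
  have h3 : ((S.image Subtype.val).card : ℕ∞) ≤ n := by
    exact_mod_cast Finset.card_image_le.trans hS
  exact absurd (h2.trans h3) (not_le.2 h)

/-- A point in an oval of a quintic with at least five ovals is not a positive combination of
positive representatives of points in three other ovals. -/
theorem not_pos_combination (hF : F.IsHomogeneous 5) (hns : IsNonsingular F)
    {D : ovals F → Set RP2} (hD : DiscChoice D) {x : ovals F → RP2}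
    (hx : ∀ O, x O ∈ interior (D O)) (hx' : ∀ O O', O ≠ O' → x O ∉ D O')
    {O₀ O₁ O₂ O₃ O₄ : ovals F} (hO : [O₀, O₁, O₂, O₃, O₄].Nodup) {v₀ v₁ v₂ : Fin 3 → ℝ}
    (hv₀ : v₀ ≠ 0) (hv₁ : v₁ ≠ 0) (hv₂ : v₂ ≠ 0)
    (hx₀ : toRP v₀ = x O₀) (hx₁ : toRP v₁ = x O₁) (hx₂ : toRP v₂ = x O₂)
    (hF₀ : 0 < eval v₀ F) (hF₁ : 0 < eval v₁ F) (hF₂ : 0 < eval v₂ F) :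
    toRP (v₀ + v₁ + v₂) ≠ x O₃ := by
  intro hx₃
  simp only [List.nodup_cons, List.mem_cons, List.not_mem_nil, or_false, not_or,
    not_false_eq_true, List.nodup_nil, and_true] at hO
  obtain ⟨⟨h01, h02, h03, h04⟩, ⟨h12, h13, h14⟩, ⟨h23, h24⟩, h34⟩ := hO
  have hv : Independent₃ v₀ v₁ v₂ :=
    independent₃_of_ovals hF hD hx hx' h01 h02 h12 hv₀ hv₁ hv₂ hx₀ hx₁ hx₂
  have hv₃ : v₀ + v₁ + v₂ ≠ 0 := fun h => one_ne_zero (hv 1 1 1 (by simpa using h)).1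
  obtain ⟨a, b, c, habc⟩ := hv.exists_coords (x O₄).rep
  have hx₄ : toRP (a • v₀ + b • v₁ + c • v₂) = x O₄ := by rw [← habc, toRP_rep]
  have hv₄ : a • v₀ + b • v₁ + c • v₂ ≠ 0 := habc ▸ (x O₄).rep_nonzero
  -- Nondegeneracy of the conic is non-collinearity: a zero coordinate puts the fifth point on a
  -- side line of the triangle, and two equal coordinates put it on the line joining v₀ + v₁ + v₂ to
  -- the remaining vertex.
  have nc : ∀ {A B : ovals F} {u w : Fin 3 → ℝ} {s t : ℝ}, A ≠ B → A ≠ O₄ → B ≠ O₄ → u ≠ 0 →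
      w ≠ 0 → toRP u = x A → toRP w = x B → a • v₀ + b • v₁ + c • v₂ ≠ s • u + t • w := by
    intro A B u w s t hAB hA hB hu hw hu' hw' h
    rw [h] at hx₄ hv₄
    exact not_collinear hF hD hx hx' hAB hA hB hu hw hu' hw' hv₄ hx₄
  refine false_of_conic hF hns hD hx hx' (O₀ := O₀) (O₁ := O₁) (O₂ := O₂) (O₃ := O₃) (O₄ := O₄)
    (by simp [*]) hv hx₀ hx₁ hx₂ hx₃ (r₀ := a) (r₁ := b) (r₂ := c) ?_ ?_ ?_ ?_ ?_ ?_ hx₄ hF₀ hF₁ hF₂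
  · rintro rfl
    exact nc h12 h14 h24 hv₁ hv₂ hx₁ hx₂ (s := b) (t := c) (by module)
  · rintro rfl
    exact nc h02 h04 h24 hv₀ hv₂ hx₀ hx₂ (s := a) (t := c) (by module)
  · rintro rfl
    exact nc h01 h04 h14 hv₀ hv₁ hx₀ hx₁ (s := a) (t := b) (by module)
  · rintro rfl
    exact nc (Ne.symm h23) h34 h24 hv₃ hv₂ hx₃ hx₂ (s := a) (t := c - a) (by module)
  · rintro rfl
    exact nc (Ne.symm h13) h34 h14 hv₃ hv₁ hx₃ hx₁ (s := a) (t := b - a) (by module)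
  · rintro rfl
    exact nc (Ne.symm h03) h34 h04 hv₃ hv₀ hx₃ hx₀ (s := b) (t := a - b) (by module)

/-- The ovals of a nonsingular quintic with at least five ovals are in convex position. -/
theorem inConvexPosition_ovals (hdeg : F.IsHomogeneous 5) (hns : IsNonsingular F)
    (hov : 5 ≤ (ovals F).encard) : InConvexPosition F (fun O : ovals F => (O : Set RP2)) := by
  classical
  intro x hxint i j k hij hik hjk T hT m hm
  -- Each point brings its own disc bounded by its oval; uniqueness of that disc is not needed.
  choose D hD hx using hxint
  have hov' : ((4 : ℕ) : ℕ∞) < (ovals F).encard := lt_of_lt_of_le (by norm_num) hov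
  have hx' : ∀ O O', O ≠ O' → x O ∉ D O' := by
    intro O O' hne
    obtain ⟨O'', hO''⟩ := exists_oval_notMem hov' {O, O'} (Finset.card_le_two.trans (by norm_num))
    simp only [Finset.mem_insert, Finset.mem_singleton, not_or] at hO''
    exact not_mem_disc hdeg hD hx hne (Ne.symm hO''.1) (Ne.symm hO''.2)
  obtain ⟨S₁₂, S₁₃, S₂₃, h₁₂, h₁₃, h₂₃, -, hTdisc⟩ := hT
  obtain ⟨hi, hj, e₁₂⟩ := h₁₂.exists_pos hdeg hns hD hx hx' hij
  obtain ⟨-, hk, e₁₃⟩ := h₁₃.exists_pos hdeg hns hD hx hx' hik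
  obtain ⟨-, -, e₂₃⟩ := h₂₃.exists_pos hdeg hns hD hx hx' hjk
  obtain ⟨v₀, hv₀, hx₀, hF₀⟩ := exists_pos_representative hdeg (by decide) hi
  obtain ⟨v₁, hv₁, hx₁, hF₁⟩ := exists_pos_representative hdeg (by decide) hj
  obtain ⟨v₂, hv₂, hx₂, hF₂⟩ := exists_pos_representative hdeg (by decide) hk
  rw [e₁₂ v₀ v₁ hv₀ hv₁ hx₀ hx₁ hF₀ hF₁, e₁₃ v₀ v₂ hv₀ hv₂ hx₀ hx₂ hF₀ hF₂,
    e₂₃ v₁ v₂ hv₁ hv₂ hx₁ hx₂ hF₁ hF₂] at hTdisc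
  have hv : Independent₃ v₀ v₁ v₂ :=
    independent₃_of_ovals hdeg hD hx hx' hij hik hjk hv₀ hv₁ hv₂ hx₀ hx₁ hx₂
  have hm' := hTdisc.not_mem_boundary_of_mem_interior hm
  have hmi : m ≠ i := by
    rintro rfl
    exact hm' (Or.inl (Or.inl (mem_projSegment_iff.2
      ⟨1, 0, zero_le_one, le_rfl, by simpa using hv₀, by simpa using hx₀⟩)))
  have hmj : m ≠ j := by
    rintro rfl
    exact hm' (Or.inl (Or.inl (mem_projSegment_iff.2
      ⟨0, 1, le_rfl, zero_le_one, by simpa using hv₁, by simpa using hx₁⟩)))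
  have hmk : m ≠ k := by
    rintro rfl
    exact hm' (Or.inl (Or.inr (mem_projSegment_iff.2
      ⟨0, 1, le_rfl, zero_le_one, by simpa using hv₂, by simpa using hx₂⟩)))
  obtain ⟨a, b, c, ha, hb, hc, habc⟩ := hv.exists_pos_of_mem_interior hTdisc hm
  -- Five ovals are needed here: the conic requires a fifth point.
  obtain ⟨l, hl⟩ := exists_oval_notMem hov' {i, j, k, m} Finset.card_le_four
  simp only [Finset.mem_insert, Finset.mem_singleton, not_or] at hl
  obtain ⟨hli, hlj, hlk, hlm⟩ := hl
  have hpos : ∀ {r : ℝ} {v : Fin 3 → ℝ}, 0 < r → 0 < eval v F →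
      0 < eval (r • v) F := by
    intro r v hr h
    rw [eval_smul_of_isHomogeneous hdeg]
    positivity
  -- The positive coefficients are absorbed into the representatives, on which F stays positive.
  exact not_pos_combination hdeg hns hD hx hx' (O₀ := i) (O₁ := j) (O₂ := k) (O₃ := m) (O₄ := l)
    (by
      simp only [List.nodup_cons, List.mem_cons, List.not_mem_nil, or_false, not_or,
        not_false_eq_true, List.nodup_nil, and_true]
      exact ⟨⟨hij, hik, hmi.symm, Ne.symm hli⟩, ⟨hjk, hmj.symm, Ne.symm hlj⟩,
        ⟨hmk.symm, Ne.symm hlk⟩, Ne.symm hlm⟩)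
    (smul_ne_zero ha.ne' hv₀) (smul_ne_zero hb.ne' hv₁) (smul_ne_zero hc.ne' hv₂)
    (by rw [toRP_smul ha.ne', hx₀]) (by rw [toRP_smul hb.ne', hx₁]) (by rw [toRP_smul hc.ne', hx₂])
    (hpos ha hF₀) (hpos hb hF₁) (hpos hc hF₂) habc

end Ovals

end

end RealPlaneCurve

theorem mainTheorem10 (F : MvPolynomial (Fin 3) ℝ) (hdeg : F.IsHomogeneous 5)
    (hns : RealPlaneCurve.IsNonsingular F) (hov : 5 ≤ (RealPlaneCurve.ovals F).encard) :
    RealPlaneCurve.InConvexPosition F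
      (fun O : RealPlaneCurve.ovals F => (O : Set RealPlaneCurve.RP2)) :=
  RealPlaneCurve.inConvexPosition_ovals hdeg hns hov
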